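/- **Theorem 1.1.** Let $J\subset\mathbb R$ be a bounded interval of positive length and let $p:J\to\mathbb R$ satisfy $1<p_-\le p(x)\le p_+<\infty$ for all $x\in J$, with constants $p_-,p_+$. Suppose that $p$ is locally log-Hölder continuous on $J$: there is $C>0$ such that $|p(x)-p(y)|\le \dfrac{C}{-\ln|x-y|}$ for all $x,y\in J$ with $0<|x-y|\le \tfrac12$. Put $p'(x)=\frac{p(x)}{p(x)-1}$ and let $0\le\alpha<1$. Let $v,w$ be real-valued measurable functions on $J$ such that $w>0$ a.e. on $J$, $v\ge 0$ a.e. on $J$ and $v$ is not a.e. zero on $J$. Put $\sigma=w^{-p'(\cdot)}$ and suppose that the measure $\sigma\,dx$ is doubling on $J$: there is $b>0$ such that $$\int_{(x-2r,x+2r)\cap J}\sigma\le b\int_{(x-r,x+r)\cap J}\sigma\qquad\text{for all }x\in J,\ 0<r<|J|$$ (the integrals have values in $[0,\infty]$). For measurable $f$ on $J$ and $x\in J$ let $$M^{(J)}_\alpha f(x)=\sup_{I\ni x,\ I\subset J}\frac1{|I|^{1-\alpha}}\int_I|f(y)|\,dy,$$ the supremum being over intervals $I$ of positive length, and let $\|g\|_{L^{p(\cdot)}(J)}=\inf\{\lambda>0:\int_J|g(x)/\lambda|^{p(x)}dx\le1\}$,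 with $\inf\emptyset=\infty$. Then the following are equivalent (with the convention $0\cdot\infty=0$). (i) There is a constant $c>0$ such that $\|v\,M^{(J)}_\alpha f\|_{L^{p(\cdot)}(J)}\le c\,\|wf\|_{L^{p(\cdot)}(J)}$ for all measurable $f:J\to\mathbb R$. (ii) There is a constant $c>0$ such that for every interval $I\subset J$, $$\int_I v(x)^{p(x)}\big(M^{(J)}_\alpha(w^{-p'(\cdot)}\chi_I)(x)\big)^{p(x)}dx\le c\int_I w(x)^{-p'(x)}dx<\infty.$$ -/

import Mathlib

open Set MeasureTheory
open scoped ENNReal NNReal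

noncomputable section

namespace VarExp

/-- The conjugate exponent `p'(x) = p(x) / (p(x) - 1)`. -/
def conjExp (p : ℝ → ℝ) (x : ℝ) : ℝ := p x / (p x - 1)

/-- The modular `S_p(g) = ∫_J g(x)^{p(x)} dx` of a function with values in `[0, ∞]`
(applied to absolute values of functions). -/
def modular (J : Set ℝ) (p : ℝ → ℝ) (g : ℝ → ℝ≥0∞) : ℝ≥0∞ :=
  ∫⁻ x in J, g x ^ p x

/-- The Luxemburg norm `inf {l > 0 : S_p(g / l) ≤ 1}` of `L^{p(·)}(J)`. It is `∞` when there is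
no such `l`, that is, when `g` is not in the space. -/
def lpNorm (J : Set ℝ) (p : ℝ → ℝ) (g : ℝ → ℝ≥0∞) : ℝ≥0∞ :=
  ⨅ (l : ℝ≥0) (_ : 0 < l) (_ : modular J p (fun x => g x / (l : ℝ≥0∞)) ≤ 1), (l : ℝ≥0∞)

/-- The fractional maximal function on `J`: the supremum over all intervals `I` with
`x ∈ I ⊆ J` of `|I|^{-(1-α)} ∫_I g`, for `g ≥ 0`. A one-point interval contributes `0 / 0 = 0`. -/
def fracMaximal (J : Set ℝ) (α : ℝ) (g : ℝ → ℝ≥0∞) (x : ℝ) : ℝ≥0∞ :=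
  ⨆ (I : Set ℝ) (_ : I.OrdConnected) (_ : x ∈ I) (_ : I ⊆ J),
    (∫⁻ y in I, g y) / volume I ^ (1 - α)

/-- The doubling condition `u ∈ DC(J)` for the measure `u dx` on the bounded interval `J`. -/
def DoublingOn (J : Set ℝ) (u : ℝ → ℝ≥0∞) : Prop :=
  ∃ b : ℝ, 0 < b ∧ ∀ x ∈ J, ∀ r : ℝ, 0 < r → r < (volume J).toReal →
    ∫⁻ y in Ioo (x - 2 * r) (x + 2 * r) ∩ J, u y ≤
      ENNReal.ofReal b * ∫⁻ y in Ioo (x - r) (x + r) ∩ J, u y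

/-- The local log-Hölder condition `p ∈ LH(J)`. -/
def LogHolderOn (J : Set ℝ) (p : ℝ → ℝ) : Prop :=
  ∃ c : ℝ, 0 < c ∧ ∀ x ∈ J, ∀ y ∈ J, x ≠ y → |x - y| ≤ 1 / 2 →
    |p x - p y| ≤ c / (-Real.log |x - y|)

/-- The function `w^{-p'(·)}`, with values in `[0, ∞]`. -/
def dualWeight (p w : ℝ → ℝ) (x : ℝ) : ℝ≥0∞ :=
  ENNReal.ofReal (w x) ^ (-conjExp p x)

/-- The two-weight inequality `‖v M_α f‖ ≤ c ‖w f‖` in `L^{p(·)}(J)`, for all measurable `f`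
on `J`, with one constant. -/
def TwoWeightInequality (J : Set ℝ) (p : ℝ → ℝ) (α : ℝ) (v w : ℝ → ℝ) : Prop :=
  ∃ c : ℝ, 0 < c ∧ ∀ f : ℝ → ℝ, AEMeasurable f (volume.restrict J) →
    lpNorm J p (fun x => ENNReal.ofReal (v x) * fracMaximal J α (fun y => ‖f y‖ₑ) x) ≤
      ENNReal.ofReal c * lpNorm J p (fun x => ENNReal.ofReal (w x) * ‖f x‖ₑ)

/-- The testing condition: for one constant `c` and all intervals `I ⊆ J`,
`∫_I v^{p(x)} (M_α (w^{-p'} χ_I))^{p(x)} dx ≤ c ∫_I w^{-p'} < ∞`. -/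
def TestingCondition (J : Set ℝ) (p : ℝ → ℝ) (α : ℝ) (v w : ℝ → ℝ) : Prop :=
  ∃ c : ℝ, 0 < c ∧ ∀ I : Set ℝ, I.OrdConnected → I ⊆ J →
    (∫⁻ x in I, ENNReal.ofReal (v x) ^ p x *
        fracMaximal J α (I.indicator (dualWeight p w)) x ^ p x) ≤
      ENNReal.ofReal c * ∫⁻ x in I, dualWeight p w x ∧
    ∫⁻ x in I, dualWeight p w x < ∞

end VarExp

end

/-!
Write `σ = w^{-p'(·)}`. Log-Hölder continuity of `p` together with doubling of `σ dx` makes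
`(∫_I σ)^{p(x)}` and `(∫_I σ)^{p(y)}` comparable for `x, y ∈ I`, uniformly in the interval `I ⊆ J`.

*Necessity.* The two-weight inequality for truncations of `σ` gives `∫_J σ < ∞`. For `f = σ χ_I`,
normalized by `(∫_I σ)^{1/p(x₀)}` with `x₀ ∈ I`, both norms turn into modulars up to constants, by
the comparability above, and the inequality becomes the testing condition.

*Sufficiency.* Put `g = f / σ`. Then `∫ |w f|^{p(·)} = ∫ |g|^{p(·)} dν` for `dν = σ dx`, and the
average of `f` over `I` is the average of `σ` over `I` times the `ν`-average of `g`. By a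
Jensen-type inequality for variable exponents (Diening), the latter, raised to the power `p(x)`, is
controlled by the power `q = p_-` of the `ν`-average of the fixed function `g^{p(·)/q} + 1`. What
remains is a maximal operator at the constant exponent `q`, in which each interval is weighted by
its share of the testing integrand. It is of strong type `(q, q)`: the Vitali covering lemma and
the testing condition on enlarged intervals give the weak type `(1, 1)`, and integration over the
level sets does the rest.
-/

namespace VarExp

open Metric Filter Topology

section Interval

/-- The midpoint of a bounded interval. -/
noncomputable def intervalCenter (I : Set ℝ) : ℝ := (sInf I + sSup I) / 2

/-- Half the length of a bounded interval. -/
noncomputable def intervalRadius (I : Set ℝ) : ℝ := (sSup I - sInf I) / 2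

variable {I : Set ℝ}

lemma subset_closedBall_intervalCenter (hb : Bornology.IsBounded I) :
    I ⊆ closedBall (intervalCenter I) (intervalRadius I) := by
  rw [Real.closedBall_eq_Icc, intervalCenter, intervalRadius]
  refine (subset_Icc_csInf_csSup hb.bddBelow hb.bddAbove).trans (Icc_subset_Icc ?_ ?_) <;> linarith

lemma ball_intervalCenter_subset (hI : I.OrdConnected) :
    ball (intervalCenter I) (intervalRadius I) ⊆ I := by
  intro x hx
  rw [Real.ball_eq_Ioo, intervalCenter, intervalRadius] at hx
  rcases I.eq_empty_or_nonempty with rfl | hne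
  · simp only [Real.sInf_empty, Real.sSup_empty, mem_Ioo] at hx
    linarith [hx.1, hx.2]
  obtain ⟨y, hy, hyx⟩ := exists_lt_of_csInf_lt hne (show sInf I < x by linarith [hx.1])
  obtain ⟨z, hz, hxz⟩ := exists_lt_of_lt_csSup hne (show x < sSup I by linarith [hx.2])
  exact hI.out hy hz ⟨hyx.le, hxz.le⟩

lemma volume_eq_two_mul_intervalRadius (hI : I.OrdConnected) (hb : Bornology.IsBounded I) :
    volume I = ENNReal.ofReal (2 * intervalRadius I) :=
  le_antisymm
    ((measure_mono (subset_closedBall_intervalCenter hb)).trans_eq (Real.volume_closedBall _ _))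
    ((Real.volume_ball _ _).symm.trans_le (measure_mono (ball_intervalCenter_subset hI)))

lemma intervalRadius_pos (hI : I.OrdConnected) (hb : Bornology.IsBounded I)
    (hv : volume I ≠ 0) : 0 < intervalRadius I := by
  rw [volume_eq_two_mul_intervalRadius hI hb, ← pos_iff_ne_zero, ENNReal.ofReal_pos] at hv
  linarith

lemma intervalCenter_mem (hI : I.OrdConnected) (hb : Bornology.IsBounded I)
    (hv : volume I ≠ 0) : intervalCenter I ∈ I :=
  ball_intervalCenter_subset hI (mem_ball_self (intervalRadius_pos hI hb hv))

lemma measureReal_eq_two_mul_intervalRadius (hI : I.OrdConnected) (hb : Bornology.IsBounded I)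
    (hv : volume I ≠ 0) : volume.real I = 2 * intervalRadius I := by
  rw [measureReal_def, volume_eq_two_mul_intervalRadius hI hb,
    ENNReal.toReal_ofReal (by linarith [intervalRadius_pos hI hb hv])]

lemma dist_le_measureReal (hI : I.OrdConnected) (hb : Bornology.IsBounded I) {x y : ℝ}
    (hx : x ∈ I) (hy : y ∈ I) : dist x y ≤ volume.real I := by
  have h : volume (uIcc y x) ≤ volume I := measure_mono (hI.uIcc_subset hy hx)
  rw [Real.volume_interval] at h
  exact (ENNReal.ofReal_le_iff_le_toReal hb.measure_lt_top.ne).1 h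

end Interval

section Doubling

variable {X : Type*} [PseudoMetricSpace X] [MeasurableSpace X] {ν : Measure X} {J : Set X} {N : ℕ}

/-- The measure `ν` is doubling at the points of `J`, with the constant `2 ^ N`. -/
def HasDoublingExponent (ν : Measure X) (J : Set X) (N : ℕ) : Prop :=
  ∀ x ∈ J, ∀ r : ℝ, 0 < r → ν (ball x (2 * r)) ≤ 2 ^ N * ν (ball x r)

lemma HasDoublingExponent.measure_ball_two_pow_mul_le (hν : HasDoublingExponent ν J N) {x : X}
    (hx : x ∈ J) {r : ℝ} (hr : 0 < r) (n : ℕ) :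
    ν (ball x (2 ^ n * r)) ≤ (2 ^ n) ^ N * ν (ball x r) := by
  induction n with
  | zero => simp
  | succ n ih =>
    calc ν (ball x (2 ^ (n + 1) * r)) = ν (ball x (2 * (2 ^ n * r))) := by congr 2; ring
      _ ≤ 2 ^ N * ((2 ^ n) ^ N * ν (ball x r)) :=
        (hν x hx _ (by positivity)).trans (mul_le_mul_right ih _)
      _ = (2 ^ (n + 1)) ^ N * ν (ball x r) := by rw [pow_succ' (2 : ℝ≥0∞) n, mul_pow, mul_assoc]

lemma HasDoublingExponent.measure_le_of_subset_closedBall (hν : HasDoublingExponent ν J N) {x : X}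
    (hx : x ∈ J) {r m : ℝ} (hr : 0 < r) (hrm : r ≤ m) {s : Set X} (hs : s ⊆ closedBall x m) :
    ν s ≤ ENNReal.ofReal ((2 * m / r) ^ N) * ν (ball x r) := by
  obtain ⟨n, hn, hn'⟩ := exists_nat_pow_near ((one_le_div hr).2 hrm) one_lt_two
  have hsub : s ⊆ ball x (2 ^ (n + 1) * r) :=
    hs.trans (closedBall_subset_ball ((div_lt_iff₀ hr).1 hn'))
  have hm : 0 < m := hr.trans_le hrm
  have hpow : ((2 : ℝ≥0∞) ^ (n + 1)) ^ N ≤ ENNReal.ofReal ((2 * m / r) ^ N) := by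
    rw [ENNReal.ofReal_pow (by positivity)]
    gcongr
    refine ENNReal.le_ofReal_iff_toReal_le (by simp) (by positivity) |>.2 ?_
    rw [ENNReal.toReal_pow, ENNReal.toReal_ofNat, pow_succ', mul_div_assoc]
    gcongr
  exact (measure_mono hsub).trans
    ((hν.measure_ball_two_pow_mul_le hx hr (n + 1)).trans (by gcongr))

lemma DoublingOn.exists_hasDoublingExponent {J : Set ℝ} (hJ : J.OrdConnected)
    (hJb : Bornology.IsBounded J) {u : ℝ → ℝ≥0∞} (hu : DoublingOn J u) :
    ∃ N, HasDoublingExponent ((volume.restrict J).withDensity u) J N := by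
  obtain ⟨b, -, h⟩ := hu
  obtain ⟨N, hN⟩ := pow_unbounded_of_one_lt b one_lt_two
  have hball (x r : ℝ) : (volume.restrict J).withDensity u (ball x r) =
      ∫⁻ y in Ioo (x - r) (x + r) ∩ J, u y := by
    rw [withDensity_apply _ measurableSet_ball, Measure.restrict_restrict measurableSet_ball,
      Real.ball_eq_Ioo]
  refine ⟨N, fun x hx r hr => ?_⟩
  rw [hball, hball]
  by_cases hrJ : r < volume.real J
  · refine (h x hx r hr hrJ).trans ?_
    gcongr
    exact ENNReal.ofReal_le_of_le_toReal (by simpa using hN.le)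
  · have hsub : (Ioo (x - 2 * r) (x + 2 * r) ∩ J : Set ℝ) ⊆ Icc (x - r) (x + r) ∩ J := by
      rw [← Real.closedBall_eq_Icc]
      exact fun y hy => ⟨(dist_le_measureReal hJ hJb hy.2 hx).trans (not_lt.1 hrJ), hy.2⟩
    have hae : (Icc (x - r) (x + r) ∩ J : Set ℝ) =ᵐ[volume] (Ioo (x - r) (x + r) ∩ J : Set ℝ) :=
      Ioo_ae_eq_Icc.symm.inter (ae_eq_refl J)
    exact (lintegral_mono_set' ((LE.le.eventuallyLE hsub).trans hae.le)).trans
      (le_mul_of_one_le_left' (one_le_pow₀ one_le_two))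

end Doubling

section LogOscillation

variable {J : Set ℝ} {p : ℝ → ℝ}

/-- The oscillation of `p` over a subinterval `I` of `J` is at most `L / (1 + |log (ν I)|)`. For
Lebesgue measure this is the local log-Hölder condition; in general it says that `ν I` raised to
powers given by two values of `p` on `I` is the same up to a constant factor. -/
def LogOscillationLE (ν : Measure ℝ) (J : Set ℝ) (p : ℝ → ℝ) (L : ℝ) : Prop :=
  ∀ I : Set ℝ, I.OrdConnected → I ⊆ J → volume I ≠ 0 → ∀ x ∈ I, ∀ y ∈ I,
    |p x - p y| * (1 + |Real.log (ν.real I)|) ≤ L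

lemma LogOscillationLE.nonneg {ν : Measure ℝ} {L : ℝ} (h : LogOscillationLE ν J p L) {I : Set ℝ}
    (hI : I.OrdConnected) (hIJ : I ⊆ J) (hvol : volume I ≠ 0) : 0 ≤ L := by
  obtain ⟨x, hx⟩ := nonempty_of_measure_ne_zero hvol
  exact le_trans (by positivity) (h I hI hIJ hvol x hx x hx)

lemma LogHolderOn.continuousOn (h : LogHolderOn J p) : ContinuousOn p J := by
  obtain ⟨c, -, h⟩ := h
  intro x hx
  have hlog : Tendsto (fun z => c / -Real.log z) (𝓝 0) (𝓝 0) := by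
    have hcont : ContinuousAt (fun z => c / -Real.log z) 0 :=
      continuousAt_iff_punctured_nhds.2 <| by
        simpa using (tendsto_neg_atBot_atTop.comp Real.tendsto_log_nhdsNE_zero).const_div_atTop c
    simpa [ContinuousAt] using hcont
  have hdist : Tendsto (fun y => |y - x|) (𝓝[J] x) (𝓝 0) := by
    have : ContinuousWithinAt (fun y => |y - x|) J x := by fun_prop
    simpa [ContinuousWithinAt] using this
  refine tendsto_iff_dist_tendsto_zero.2
    (squeeze_zero' (.of_forall fun _ => dist_nonneg) ?_ (hlog.comp hdist))
  filter_upwards [self_mem_nhdsWithin, hdist.eventually_le_const (show (0 : ℝ) < 1 / 2 by norm_num)]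
    with y hy hxy
  rcases eq_or_ne y x with rfl | hne
  · simp
  · exact h y hy x hx hne hxy

lemma LogHolderOn.exists_logOscillationLE (hJb : Bornology.IsBounded J) {pminus pplus : ℝ}
    (hp : ∀ x ∈ J, p x ∈ Icc pminus pplus) (h : LogHolderOn J p) :
    ∃ K, LogOscillationLE volume J p K := by
  obtain ⟨c, hc, h⟩ := h
  set R := 1 + Real.log 2 + |Real.log (volume.real J)|
  have hlog2 : 0 < Real.log 2 := Real.log_pos one_lt_two
  refine ⟨max (c / Real.log 2 + c) ((pplus - pminus) * R), fun I hI hIJ hv x hx y hy => ?_⟩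
  have hIb := hJb.subset hIJ
  set δ := volume.real I
  have hδ : 0 < δ := ENNReal.toReal_pos hv hIb.measure_lt_top.ne
  rcases eq_or_ne x y with rfl | hxy
  · rw [sub_self, abs_zero, zero_mul]
    exact le_max_of_le_left (by positivity)
  rcases le_or_gt δ (1 / 2) with hδ2 | hδ2
  · have hdist : |x - y| ≤ δ := dist_le_measureReal hI hIb hx hy
    have hlogδ : Real.log 2 ≤ -Real.log δ := by
      rw [← Real.log_inv]
      exact Real.log_le_log two_pos ((le_inv_comm₀ two_pos hδ).2 (by linarith))
    have hosc : |p x - p y| ≤ c / -Real.log δ := by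
      refine (h x (hIJ hx) y (hIJ hy) hxy (hdist.trans hδ2)).trans ?_
      have hlog := Real.log_le_log (abs_pos.2 (sub_ne_zero.2 hxy)) hdist
      gcongr
      exact hlog2.trans_le hlogδ
    refine le_max_of_le_left ?_
    rw [abs_of_neg (by linarith : Real.log δ < 0)]
    calc |p x - p y| * (1 + -Real.log δ) ≤ c / -Real.log δ * (1 + -Real.log δ) := by
          gcongr
          linarith
      _ = c / -Real.log δ + c := by
          rw [mul_add, mul_one, div_mul_cancel₀ _ (hlog2.trans_le hlogδ).ne']
      _ ≤ c / Real.log 2 + c := by gcongr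
  · have hδJ : δ ≤ volume.real J := measureReal_mono hIJ hJb.measure_lt_top.ne
    have hlogδ : |Real.log δ| ≤ Real.log 2 + |Real.log (volume.real J)| := by
      have hlow := Real.log_le_log (by norm_num) hδ2.le
      rw [one_div, Real.log_inv] at hlow
      refine abs_le.2 ⟨by linarith [abs_nonneg (Real.log (volume.real J))], ?_⟩
      linarith [Real.log_le_log hδ hδJ, le_abs_self (Real.log (volume.real J))]
    refine le_max_of_le_right ?_
    have hosc : |p x - p y| ≤ pplus - pminus := by
      have hpx := hp x (hIJ hx)
      have hpy := hp y (hIJ hy)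
      exact abs_sub_le_of_le_of_le hpx.1 hpx.2 hpy.1 hpy.2
    exact mul_le_mul hosc (by linarith) (by positivity) ((abs_nonneg _).trans hosc)

variable {ν : Measure ℝ} [IsFiniteMeasure ν] {N : ℕ}

lemma HasDoublingExponent.measureReal_le (hν : HasDoublingExponent ν J N) (hJ : J.OrdConnected)
    (hJb : Bornology.IsBounded J) {I : Set ℝ} (hI : I.OrdConnected) (hIJ : I ⊆ J)
    (hv : volume I ≠ 0) :
    ν.real J ≤ (4 * volume.real J / volume.real I) ^ N * ν.real I := by
  have hIb := hJb.subset hIJ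
  have hr := intervalRadius_pos hI hIb hv
  have hvI := measureReal_eq_two_mul_intervalRadius hI hIb hv
  have hcJ := hIJ (intervalCenter_mem hI hIb hv)
  have hvIJ : volume.real I ≤ volume.real J := measureReal_mono hIJ hJb.measure_lt_top.ne
  have hJball : J ⊆ closedBall (intervalCenter I) (volume.real J) :=
    fun y hy => dist_le_measureReal hJ hJb hy hcJ
  have hle : ν J ≤ ENNReal.ofReal ((4 * volume.real J / volume.real I) ^ N) * ν I := by
    refine (hν.measure_le_of_subset_closedBall hcJ hr (by linarith) hJball).trans ?_
    rw [show 4 * volume.real J / volume.real I = 2 * volume.real J / intervalRadius I by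
      rw [hvI, show (4 : ℝ) = 2 * 2 by norm_num, mul_assoc, mul_div_mul_left _ _ two_ne_zero]]
    gcongr
    exact ball_intervalCenter_subset hI
  have := ENNReal.toReal_mono (ENNReal.mul_ne_top ENNReal.ofReal_ne_top (measure_ne_top ν I)) hle
  rwa [ENNReal.toReal_mul, ENNReal.toReal_ofReal (by positivity)] at this

lemma HasDoublingExponent.abs_log_measureReal_le (hν : HasDoublingExponent ν J N)
    (hJ : J.OrdConnected) (hJb : Bornology.IsBounded J) (hνJ : ν J ≠ 0) {I : Set ℝ}
    (hI : I.OrdConnected) (hIJ : I ⊆ J) (hv : volume I ≠ 0) :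
    |Real.log (ν.real I)| ≤ |Real.log (ν.real J)| + N * |Real.log (4 * volume.real J)| +
      N * |Real.log (volume.real I)| := by
  have hδ : 0 < volume.real I := ENNReal.toReal_pos hv (hJb.subset hIJ).measure_lt_top.ne
  have hδJ : volume.real I ≤ volume.real J := measureReal_mono hIJ hJb.measure_lt_top.ne
  have hm := hδ.trans_le hδJ
  have hT : 0 < ν.real J := ENNReal.toReal_pos hνJ (measure_ne_top ν J)
  have hTS := hν.measureReal_le hJ hJb hI hIJ hv
  have hS : 0 < ν.real I := pos_of_mul_pos_right (hT.trans_le hTS) (by positivity)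
  have hlow : Real.log (ν.real J) ≤
      N * (Real.log (4 * volume.real J) - Real.log (volume.real I)) + Real.log (ν.real I) := by
    have := Real.log_le_log hT hTS
    rwa [Real.log_mul (by positivity) hS.ne', Real.log_pow,
      Real.log_div (by positivity) hδ.ne'] at this
  have hup : Real.log (ν.real I) ≤ Real.log (ν.real J) :=
    Real.log_le_log hS (measureReal_mono hIJ)
  have hN4m := mul_le_mul_of_nonneg_left (le_abs_self (Real.log (4 * volume.real J))) N.cast_nonneg
  have hNδ := mul_le_mul_of_nonneg_left (neg_abs_le (Real.log (volume.real I))) N.cast_nonneg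
  refine abs_le.2 ⟨?_, ?_⟩
  · linarith [neg_abs_le (Real.log (ν.real J))]
  · linarith [le_abs_self (Real.log (ν.real J))]

lemma LogOscillationLE.of_hasDoublingExponent (hν : HasDoublingExponent ν J N)
    (hJ : J.OrdConnected) (hJb : Bornology.IsBounded J) (hνJ : ν J ≠ 0) {K : ℝ}
    (h : LogOscillationLE volume J p K) :
    ∃ L, LogOscillationLE ν J p L := by
  set A := |Real.log (ν.real J)| + N * |Real.log (4 * volume.real J)|
  refine ⟨(1 + A + N) * K, fun I hI hIJ hv x hx y hy => ?_⟩
  have hlog := hν.abs_log_measureReal_le hJ hJb hνJ hI hIJ hv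
  calc |p x - p y| * (1 + |Real.log (ν.real I)|)
      ≤ |p x - p y| * ((1 + A + N) * (1 + |Real.log (volume.real I)|)) := by
        gcongr
        have : 0 ≤ (1 + A) * |Real.log (volume.real I)| := by positivity
        linarith [N.cast_nonneg (α := ℝ)]
    _ = (1 + A + N) * (|p x - p y| * (1 + |Real.log (volume.real I)|)) := by ring
    _ ≤ (1 + A + N) * K := by
        gcongr
        exact h I hI hIJ hv x hx y hy

end LogOscillation

lemma indicator_one_le_rpow_le {X : Type*} (g : X → ℝ≥0∞) {r s : ℝ} (hr : 0 < r) (hrs : r ≤ s)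
    (x : X) :
    {y | 1 ≤ g y}.indicator g x ^ r ≤ g x ^ s := by
  by_cases hx : 1 ≤ g x
  · rw [indicator_of_mem (by exact hx)]
    exact ENNReal.rpow_le_rpow_of_exponent_le hx hrs
  · rw [indicator_of_notMem (by exact hx), ENNReal.zero_rpow_of_pos hr]
    exact zero_le

lemma le_one_add_indicator_one_le {X : Type*} (g : X → ℝ≥0∞) (x : X) :
    g x ≤ 1 + {y | 1 ≤ g y}.indicator g x := by
  by_cases hx : 1 ≤ g x
  · rw [indicator_of_mem (by exact hx)]
    exact le_add_self
  · exact (not_le.1 hx).le.trans le_self_add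

section Jensen

variable {X : Type*} [MeasurableSpace X] {μ : Measure X} [IsProbabilityMeasure μ] {g : X → ℝ≥0∞}

lemma rpow_lintegral_le_lintegral_rpow (hg : AEMeasurable g μ) {r : ℝ} (hr : 1 ≤ r) :
    (∫⁻ x, g x ∂μ) ^ r ≤ ∫⁻ x, g x ^ r ∂μ := by
  have h := eLpNorm'_le_eLpNorm'_of_exponent_le one_pos hr μ hg.aestronglyMeasurable
  simp only [eLpNorm', enorm_eq_self, ENNReal.rpow_one, div_one] at h
  rwa [one_div, ENNReal.le_rpow_inv_iff (by linarith)] at h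

lemma rpow_lintegral_le_exp_mul_lintegral_rpow (hg : AEMeasurable g μ) {r P H L : ℝ}
    (hr : 1 ≤ r) (hrP : r ≤ P) (hH : 0 ≤ H) (hL : (P - r) * H ≤ L)
    (hgr : ∫⁻ x, g x ^ r ∂μ ≤ ENNReal.ofReal (Real.exp H)) :
    (∫⁻ x, g x ∂μ) ^ P ≤ ENNReal.ofReal (Real.exp L) * ∫⁻ x, g x ^ r ∂μ := by
  have hr0 : 0 < r := by linarith
  have hs : 0 ≤ (P - r) / r := div_nonneg (by linarith) hr0.le
  have hexp : (∫⁻ x, g x ^ r ∂μ) ^ ((P - r) / r) ≤ ENNReal.ofReal (Real.exp L) := by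
    refine (ENNReal.rpow_le_rpow hgr hs).trans ?_
    rw [ENNReal.ofReal_rpow_of_pos (Real.exp_pos H), ← Real.exp_mul]
    gcongr
    calc H * ((P - r) / r) = (P - r) * H / r := by ring
      _ ≤ (P - r) * H := div_le_self (mul_nonneg (by linarith) hH) hr
      _ ≤ L := hL
  calc (∫⁻ x, g x ∂μ) ^ P = ((∫⁻ x, g x ∂μ) ^ r) ^ ((P - r) / r + 1) := by
        rw [← ENNReal.rpow_mul]
        congr 1
        field_simp
        ring
    _ ≤ (∫⁻ x, g x ^ r ∂μ) ^ ((P - r) / r + 1) :=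
        ENNReal.rpow_le_rpow (rpow_lintegral_le_lintegral_rpow hg hr) (by linarith)
    _ = (∫⁻ x, g x ^ r ∂μ) ^ ((P - r) / r) * ∫⁻ x, g x ^ r ∂μ := by
        rw [ENNReal.rpow_add_of_nonneg _ _ hs zero_le_one, ENNReal.rpow_one]
    _ ≤ ENNReal.ofReal (Real.exp L) * ∫⁻ x, g x ^ r ∂μ := mul_le_mul_left hexp _

/-- Jensen's inequality is applied with the constant exponent `max 1 (P - L / H)`, which is below
`p` almost everywhere, to the part of `g` where `1 ≤ g`. -/
lemma rpow_lintegral_le_lintegral_rpow_exponent (hg : AEMeasurable g μ) {p : X → ℝ} {P H L : ℝ}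
    (hP : 1 ≤ P) (hH : 0 < H) (hL : 0 ≤ L)
    (hp : ∀ᵐ y ∂μ, 1 ≤ p y ∧ (P - p y) * H ≤ L)
    (hgp : ∫⁻ y, g y ^ p y ∂μ ≤ ENNReal.ofReal (Real.exp H)) :
    (∫⁻ y, g y ∂μ) ^ P ≤ 2 ^ P * ENNReal.ofReal (Real.exp L) * (∫⁻ y, g y ^ p y ∂μ + 1) := by
  set r := max 1 (P - L / H)
  set T := {y | 1 ≤ g y}.indicator g
  have hT : AEMeasurable T μ := hg.indicator₀ (nullMeasurableSet_le aemeasurable_const hg)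
  have hr : 1 ≤ r := le_max_left _ _
  have hrP : r ≤ P := max_le hP (by linarith [div_nonneg hL hH.le])
  have hrL : (P - r) * H ≤ L := by
    rw [← le_div_iff₀ hH]
    linarith [le_max_right 1 (P - L / H)]
  have hTr : ∫⁻ y, T y ^ r ∂μ ≤ ∫⁻ y, g y ^ p y ∂μ := by
    refine lintegral_mono_ae (hp.mono fun y ⟨hy1, hyL⟩ => ?_)
    rw [← le_div_iff₀ hH] at hyL
    exact indicator_one_le_rpow_le g (by linarith) (max_le hy1 (by linarith)) y
  have hTP := rpow_lintegral_le_exp_mul_lintegral_rpow hT hr hrP hH.le hrL (hTr.trans hgp)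
  have hgT : ∫⁻ y, g y ∂μ ≤ 1 + ∫⁻ y, T y ∂μ := by
    calc ∫⁻ y, g y ∂μ ≤ ∫⁻ y, 1 + T y ∂μ := lintegral_mono (le_one_add_indicator_one_le g)
      _ = 1 + ∫⁻ y, T y ∂μ := by rw [lintegral_add_left measurable_const]; simp
  have hexpL : 1 ≤ ENNReal.ofReal (Real.exp L) := by simpa using Real.one_le_exp hL
  calc (∫⁻ y, g y ∂μ) ^ P ≤ (1 + ∫⁻ y, T y ∂μ) ^ P := by gcongr
    _ ≤ 2 ^ (P - 1) * (1 ^ P + (∫⁻ y, T y ∂μ) ^ P) := ENNReal.rpow_add_le_mul_rpow_add_rpow _ _ hP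
    _ ≤ 2 ^ P * (ENNReal.ofReal (Real.exp L) +
          ENNReal.ofReal (Real.exp L) * ∫⁻ y, g y ^ p y ∂μ) := by
        rw [ENNReal.one_rpow]
        gcongr
        · exact one_le_two
        · linarith
        · exact hTP.trans (by gcongr)
    _ = 2 ^ P * ENNReal.ofReal (Real.exp L) * (∫⁻ y, g y ^ p y ∂μ + 1) := by ring

end Jensen

section Jensen

variable {X : Type*} [MeasurableSpace X] {ν : Measure X} [IsFiniteMeasure ν] {g : X → ℝ≥0∞}

lemma one_add_inv_measure_le_exp {B : Set X} (hB : ν B ≠ 0) :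
    1 + (ν B)⁻¹ ≤ ENNReal.ofReal (Real.exp (1 + |Real.log (ν.real B)|)) := by
  have hpos : 0 < ν.real B := ENNReal.toReal_pos hB (measure_ne_top ν B)
  have hinv : (ν.real B)⁻¹ ≤ Real.exp |Real.log (ν.real B)| := by
    rw [← Real.exp_log (inv_pos.2 hpos), Real.log_inv]
    exact Real.exp_le_exp.2 (neg_le_abs _)
  have hone : 1 ≤ Real.exp |Real.log (ν.real B)| := Real.one_le_exp (abs_nonneg _)
  have htwo : 2 ≤ Real.exp 1 := by linarith [Real.add_one_le_exp 1]
  rw [← ofReal_measureReal, ← ENNReal.ofReal_inv_of_pos hpos, ← ENNReal.ofReal_one,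
    ← ENNReal.ofReal_add zero_le_one (inv_nonneg.2 hpos.le), Real.exp_add]
  exact ENNReal.ofReal_le_ofReal (by nlinarith)

lemma rpow_le_one_add_rpow_of_le (a : ℝ≥0∞) {r s : ℝ} (hr : 0 ≤ r) (hrs : r ≤ s) :
    a ^ r ≤ 1 + a ^ s := by
  rcases le_total a 1 with ha | ha
  · exact (ENNReal.rpow_le_one ha hr).trans le_self_add
  · exact (ENNReal.rpow_le_rpow_of_exponent_le ha hrs).trans le_add_self

lemma setLAverage_rpow_div_le_exp {B : Set X} (hB : ν B ≠ 0) {p : X → ℝ} {q : ℝ} (hq : 1 ≤ q)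
    (hp : ∀ᵐ y ∂ν.restrict B, q ≤ p y) (hgp : ∫⁻ y in B, g y ^ p y ∂ν ≤ 1) :
    ⨍⁻ y in B, g y ^ (p y / q) ∂ν ≤
      ENNReal.ofReal (Real.exp (1 + |Real.log (ν.real B)|)) := by
  calc ⨍⁻ y in B, g y ^ (p y / q) ∂ν
      = (∫⁻ y in B, g y ^ (p y / q) ∂ν) / ν B := setLAverage_eq ..
    _ ≤ (∫⁻ y in B, 1 + g y ^ p y ∂ν) / ν B := by
        refine ENNReal.div_le_div_right (lintegral_mono_ae (hp.mono fun y hqy => ?_)) _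
        have hpy : 0 ≤ p y := by linarith
        exact rpow_le_one_add_rpow_of_le _ (by positivity) (div_le_self hpy hq)
    _ = 1 + (∫⁻ y in B, g y ^ p y ∂ν) / ν B := by
        rw [lintegral_add_left measurable_const, setLIntegral_one, ENNReal.add_div,
          ENNReal.div_self hB (measure_ne_top ν B)]
    _ ≤ 1 + (ν B)⁻¹ := by
        gcongr
        exact (ENNReal.div_le_div_right hgp _).trans_eq (one_div _)
    _ ≤ _ := one_add_inv_measure_le_exp hB

lemma setLAverage_rpow_le {B : Set X} (hB : ν B ≠ 0) (hg : AEMeasurable g (ν.restrict B))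
    {p : X → ℝ} {q P L : ℝ} (hq : 1 ≤ q) (hqP : q ≤ P) (hL : 0 ≤ L)
    (hp : ∀ᵐ y ∂ν.restrict B, q ≤ p y ∧ (P - p y) * (1 + |Real.log (ν.real B)|) ≤ L)
    (hgp : ∫⁻ y in B, g y ^ p y ∂ν ≤ 1) :
    (⨍⁻ y in B, g y ∂ν) ^ P ≤
      2 ^ P * ENNReal.ofReal (Real.exp (L * q)) * (⨍⁻ y in B, (g y ^ (p y / q) + 1) ∂ν) ^ q := by
  have hq0 : 0 < q := by linarith
  set μ := ProbabilityTheory.cond ν B with hμ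
  have : IsProbabilityMeasure μ := ProbabilityTheory.cond_isProbabilityMeasure hB
  have haverage (f : X → ℝ≥0∞) : ⨍⁻ y in B, f y ∂ν = ∫⁻ y, f y ∂μ := by
    rw [setLAverage_eq', hμ, ProbabilityTheory.cond]
  have hpq : ∀ᵐ y ∂μ, 1 ≤ p y / q ∧ (P / q - p y / q) * (1 + |Real.log (ν.real B)|) ≤ L := by
    refine Measure.ae_smul_measure (hp.mono fun y ⟨hqy, hy⟩ => ⟨(one_le_div hq0).2 hqy, ?_⟩) _
    rw [← sub_div, div_mul_eq_mul_div, div_le_iff₀ hq0]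
    exact hy.trans (le_mul_of_one_le_right hL hq)
  have hexp := setLAverage_rpow_div_le_exp hB hq (hp.mono fun y hy => hy.1) hgp
  rw [haverage] at hexp
  have hgμ : AEMeasurable g μ := hg.smul_measure _
  have hJensen := rpow_lintegral_le_lintegral_rpow_exponent hgμ ((one_le_div hq0).2 hqP)
    (by positivity) hL hpq hexp
  rw [haverage, haverage, lintegral_add_right _ measurable_const, lintegral_one, measure_univ]
  calc (∫⁻ y, g y ∂μ) ^ P = ((∫⁻ y, g y ∂μ) ^ (P / q)) ^ q := by
        rw [← ENNReal.rpow_mul, div_mul_cancel₀ _ hq0.ne']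
    _ ≤ (2 ^ (P / q) * ENNReal.ofReal (Real.exp L) * (∫⁻ y, g y ^ (p y / q) ∂μ + 1)) ^ q :=
        ENNReal.rpow_le_rpow hJensen hq0.le
    _ = 2 ^ P * ENNReal.ofReal (Real.exp (L * q)) * (∫⁻ y, g y ^ (p y / q) ∂μ + 1) ^ q := by
        rw [ENNReal.mul_rpow_of_nonneg _ _ hq0.le, ENNReal.mul_rpow_of_nonneg _ _ hq0.le,
          ← ENNReal.rpow_mul, div_mul_cancel₀ _ hq0.ne',
          ENNReal.ofReal_rpow_of_pos (Real.exp_pos L), ← Real.exp_mul]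

end Jensen

section LayerCake

lemma rpow_eq_lintegral_indicator (a : ℝ≥0∞) {s : ℝ} (hs : 0 < s) :
    a ^ s = ENNReal.ofReal s * ∫⁻ t in Ioi (0 : ℝ),
      {t : ℝ | ENNReal.ofReal t < a}.indicator (fun t => ENNReal.ofReal (t ^ (s - 1))) t := by
  have hfin (b : ℝ≥0) : (b : ℝ≥0∞) ^ s = ENNReal.ofReal s * ∫⁻ t in Ioi (0 : ℝ),
      {t : ℝ | ENNReal.ofReal t < b}.indicator (fun t => ENNReal.ofReal (t ^ (s - 1))) t := by
    have h := lintegral_rpow_eq_lintegral_meas_lt_mul (Measure.dirac ()) (f := fun _ => (b : ℝ))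
      (.of_forall fun _ => b.coe_nonneg) aemeasurable_const hs
    rw [lintegral_dirac, ← ENNReal.ofReal_rpow_of_nonneg b.coe_nonneg hs.le,
      ENNReal.ofReal_coe_nnreal] at h
    rw [h]
    congr 1
    refine setLIntegral_congr_fun measurableSet_Ioi fun t ht => ?_
    have hiff : ENNReal.ofReal t < b ↔ t < b := by
      rw [← ENNReal.ofReal_coe_nnreal, ENNReal.ofReal_lt_ofReal_iff_of_nonneg (le_of_lt ht)]
    by_cases hta : t < b <;> simp [indicator, hiff, hta]
  induction a with
  | coe b => exact hfin b
  | top =>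
    rw [ENNReal.top_rpow_of_pos hs, eq_comm]
    refine ENNReal.eq_top_of_forall_nnreal_le fun r => ?_
    calc (r : ℝ≥0∞) = ((r ^ s⁻¹ : ℝ≥0) : ℝ≥0∞) ^ s := by
          rw [← ENNReal.coe_rpow_of_nonneg _ hs.le, NNReal.rpow_inv_rpow hs.ne']
      _ ≤ _ := by
          rw [hfin]
          gcongr
          exact le_top

variable {X : Type*} [MeasurableSpace X] {μ : Measure X} [SFinite μ]

lemma lintegral_rpow_eq_lintegral_measure_lt {f : X → ℝ≥0∞} (hf : AEMeasurable f μ) {s : ℝ}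
    (hs : 0 < s) :
    ∫⁻ x, f x ^ s ∂μ = ENNReal.ofReal s *
      ∫⁻ t in Ioi (0 : ℝ), ENNReal.ofReal (t ^ (s - 1)) * μ {x | ENNReal.ofReal t < f x} := by
  have hpow : Measurable fun t : ℝ => ENNReal.ofReal (t ^ (s - 1)) := by fun_prop
  have hmeas : AEMeasurable (Function.uncurry fun x t => {t : ℝ | ENNReal.ofReal t < f x}.indicator
      (fun t => ENNReal.ofReal (t ^ (s - 1))) t) (μ.prod (volume.restrict (Ioi 0))) :=
    AEMeasurable.indicator₀ (hpow.comp measurable_snd).aemeasurable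
      (nullMeasurableSet_lt (ENNReal.measurable_ofReal.comp measurable_snd).aemeasurable
        hf.comp_fst)
  simp only [rpow_eq_lintegral_indicator _ hs]
  rw [lintegral_const_mul' _ _ ENNReal.ofReal_ne_top, lintegral_lintegral_swap hmeas]
  congr 2 with t
  exact lintegral_indicator_const₀ (nullMeasurableSet_lt aemeasurable_const hf) _

lemma iSup_mul_rpow_le {ι : Type*} (φ A : ι → ℝ≥0∞) {q : ℝ} (hq : 0 < q) :
    ⨆ i, φ i * A i ^ q ≤ ENNReal.ofReal q * ∫⁻ t in Ioi (0 : ℝ),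
      ENNReal.ofReal (t ^ (q - 1)) * ⨆ i, ⨆ (_ : ENNReal.ofReal t < A i), φ i := by
  refine iSup_le fun i => ?_
  have hmeas : Measurable ({t : ℝ | ENNReal.ofReal t < A i}.indicator
      fun t => ENNReal.ofReal (t ^ (q - 1))) :=
    Measurable.indicator (by fun_prop) (measurableSet_lt ENNReal.measurable_ofReal measurable_const)
  rw [rpow_eq_lintegral_indicator (A i) hq, mul_left_comm, ← lintegral_const_mul _ hmeas]
  refine mul_le_mul_right (lintegral_mono fun t => ?_) _
  dsimp only
  by_cases ht : ENNReal.ofReal t < A i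
  · rw [indicator_of_mem (by exact ht), mul_comm]
    gcongr
    exact le_iSup₂_of_le i ht le_rfl
  · simp [ht]

lemma lintegral_iSup_mul_rpow_le_lintegral_lintegral {ι : Type*} [Countable ι]
    {φ : ι → X → ℝ≥0∞} (hφ : ∀ i, AEMeasurable (φ i) μ) (A : ι → ℝ≥0∞) {q : ℝ} (hq : 0 < q) :
    ∫⁻ x, ⨆ i, φ i x * A i ^ q ∂μ ≤ ENNReal.ofReal q * ∫⁻ t in Ioi (0 : ℝ),
      ENNReal.ofReal (t ^ (q - 1)) * ∫⁻ x, ⨆ i, ⨆ (_ : ENNReal.ofReal t < A i), φ i x ∂μ := by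
  have hsup : AEMeasurable (fun z : X × ℝ => ⨆ i, ⨆ (_ : ENNReal.ofReal z.2 < A i), φ i z.1)
      (μ.prod (volume.restrict (Ioi 0))) := by
    refine .iSup fun i => ?_
    refine ((hφ i).comp_fst.indicator
      (measurableSet_lt (ENNReal.measurable_ofReal.comp measurable_snd)
        (measurable_const (a := A i)))).congr (.of_forall fun z => ?_)
    by_cases hz : ENNReal.ofReal z.2 < A i <;> simp [hz]
  have hmeas : AEMeasurable (Function.uncurry fun (x : X) (t : ℝ) =>
      ENNReal.ofReal (t ^ (q - 1)) * ⨆ i, ⨆ (_ : ENNReal.ofReal t < A i), φ i x)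
      (μ.prod (volume.restrict (Ioi 0))) :=
    (by fun_prop : Measurable fun z : X × ℝ => ENNReal.ofReal (z.2 ^ (q - 1))).aemeasurable.mul hsup
  refine (lintegral_mono fun x => iSup_mul_rpow_le (fun i => φ i x) A hq).trans_eq ?_
  rw [lintegral_const_mul' _ _ ENNReal.ofReal_ne_top, lintegral_lintegral_swap hmeas]
  simp only [lintegral_const_mul' _ _ ENNReal.ofReal_ne_top]

lemma ofReal_mul_lintegral_rpow_mul_setLIntegral_le {G : X → ℝ≥0∞} (hG : AEMeasurable G μ) {q : ℝ}
    (hq : 1 < q) :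
    ENNReal.ofReal (q - 1) * ∫⁻ t in Ioi (0 : ℝ), ENNReal.ofReal (t ^ (q - 1 - 1)) *
      ∫⁻ y in {y | ENNReal.ofReal t < 2 * G y}, G y ∂μ ≤ ∫⁻ y, (2 * G y) ^ q ∂μ := by
  have hG2 : AEMeasurable (fun y => 2 * G y) μ := hG.const_mul 2
  have hlevel (t : ℝ) : ∫⁻ y in {y | ENNReal.ofReal t < 2 * G y}, G y ∂μ =
      μ.withDensity G {y | ENNReal.ofReal t < 2 * G y} :=
    (withDensity_apply₀ G (nullMeasurableSet_lt aemeasurable_const hG2)).symm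
  simp only [hlevel]
  rw [← lintegral_rpow_eq_lintegral_measure_lt
      (hG2.mono_ac (withDensity_absolutelyContinuous μ G)) (by linarith),
    lintegral_withDensity_eq_lintegral_mul₀ hG (hG2.pow_const _)]
  refine lintegral_mono fun y => ?_
  calc G y * (2 * G y) ^ (q - 1) ≤ (2 * G y) ^ (1 : ℝ) * (2 * G y) ^ (q - 1) := by
        rw [ENNReal.rpow_one]
        gcongr
        exact le_mul_of_one_le_left' one_le_two
    _ = (2 * G y) ^ q := by
        rw [← ENNReal.rpow_add_of_nonneg _ _ zero_le_one (by linarith), add_sub_cancel]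

/-- The interpolation step of the Marcinkiewicz theorem, between the given weak-type bound and the
trivial bound in `L^∞`, for which the factor `2` in the level sets of `G` leaves room. -/
lemma lintegral_iSup_mul_rpow_le_of_weakType {ι Y : Type*} [Countable ι] [MeasurableSpace Y]
    {ν : Measure Y} [SFinite ν] {φ : ι → X → ℝ≥0∞} (hφ : ∀ i, AEMeasurable (φ i) μ)
    (A : ι → ℝ≥0∞) {G : Y → ℝ≥0∞} (hG : AEMeasurable G ν) {q : ℝ} (hq : 1 < q) {C : ℝ≥0∞}
    (hC : C ≠ ∞)
    (hweak : ∀ t : ℝ, 0 < t → ∫⁻ x, ⨆ i, ⨆ (_ : ENNReal.ofReal t < A i), φ i x ∂μ ≤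
      C * (ENNReal.ofReal t)⁻¹ * ∫⁻ y in {y | ENNReal.ofReal t < 2 * G y}, G y ∂ν) :
    ∫⁻ x, ⨆ i, φ i x * A i ^ q ∂μ ≤
      ENNReal.ofReal q * C * (ENNReal.ofReal (q - 1))⁻¹ * ∫⁻ y, (2 * G y) ^ q ∂ν := by
  have hq1 : ENNReal.ofReal (q - 1) ≠ 0 := by simpa using hq
  calc ∫⁻ x, ⨆ i, φ i x * A i ^ q ∂μ
      ≤ ENNReal.ofReal q * ∫⁻ t in Ioi (0 : ℝ), ENNReal.ofReal (t ^ (q - 1)) *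
          ∫⁻ x, ⨆ i, ⨆ (_ : ENNReal.ofReal t < A i), φ i x ∂μ :=
        lintegral_iSup_mul_rpow_le_lintegral_lintegral hφ A (by linarith)
    _ ≤ ENNReal.ofReal q * ∫⁻ t in Ioi (0 : ℝ), C * (ENNReal.ofReal (t ^ (q - 1 - 1)) *
          ∫⁻ y in {y | ENNReal.ofReal t < 2 * G y}, G y ∂ν) := by
        refine mul_le_mul_right (setLIntegral_mono' measurableSet_Ioi fun t (ht : 0 < t) => ?_) _
        refine (mul_le_mul_right (hweak t ht) _).trans_eq ?_
        rw [Real.rpow_sub_one ht.ne' (q - 1), ENNReal.ofReal_div_of_pos ht, div_eq_mul_inv]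
        ring
    _ = ENNReal.ofReal q * C * (ENNReal.ofReal (q - 1))⁻¹ * (ENNReal.ofReal (q - 1) *
          ∫⁻ t in Ioi (0 : ℝ), ENNReal.ofReal (t ^ (q - 1 - 1)) *
            ∫⁻ y in {y | ENNReal.ofReal t < 2 * G y}, G y ∂ν) := by
        rw [lintegral_const_mul' _ _ hC, ← mul_assoc (_ * _ * _),
          mul_assoc _ _⁻¹, ENNReal.inv_mul_cancel hq1 ENNReal.ofReal_ne_top, mul_one, mul_assoc]
    _ ≤ _ := mul_le_mul_right (ofReal_mul_lintegral_rpow_mul_setLIntegral_le hG hq) _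

end LayerCake

section MaximalBound

variable {ι X : Type*}

/-- Every subfamily of `B` contains a disjoint one whose enlargements `K` cover the subfamily, as
in Vitali's covering lemma. -/
def HasVitaliEnlargement (B K : ι → Set X) : Prop :=
  ∀ T : Set ι, ∃ u ⊆ T, u.PairwiseDisjoint B ∧ ∀ j ∈ T, ∃ i ∈ u, B j ⊆ K i

lemma hasVitaliEnlargement_of_bounded {B K : ι → Set X} {δ : ι → ℝ} {R : ℝ}
    (hB : ∀ i, (B i).Nonempty) (hδ : ∀ i, δ i ∈ Icc 0 R)
    (hBK : ∀ i j, (B j ∩ B i).Nonempty → δ j ≤ 2 * δ i → B j ⊆ K i) :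
    HasVitaliEnlargement B K := by
  intro T
  obtain ⟨u, huT, hdisj, hcov⟩ := Vitali.exists_disjoint_subfamily_covering_enlargement B T δ 2
    one_lt_two (fun i _ => (hδ i).1) R (fun i _ => (hδ i).2) (fun i _ => hB i)
  refine ⟨u, huT, hdisj, fun j hj => ?_⟩
  obtain ⟨i, hi, hij, hδij⟩ := hcov j hj
  exact ⟨i, hi, hBK i j hij hδij⟩

variable [MeasurableSpace X] {μ ν : Measure X} [IsFiniteMeasure ν]

lemma measure_le_of_lt_setLAverage {B : Set X} {G : X → ℝ≥0∞} {t : ℝ≥0∞} (ht0 : t ≠ 0)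
    (htT : t ≠ ∞) (h : t < ⨍⁻ y in B, G y ∂ν) :
    ν B ≤ 2 * t⁻¹ * ∫⁻ y in B, {y | t < 2 * G y}.indicator G y ∂ν := by
  set E := {y | t < 2 * G y}.indicator G
  have hGE (y : X) : G y ≤ E y + t / 2 := by
    by_cases hy : t < 2 * G y
    · exact (indicator_of_mem (show y ∈ {y | t < 2 * G y} from hy) G).ge.trans le_self_add
    · exact le_add_left
        ((ENNReal.le_div_iff_mul_le (by simp) (by simp)).2 (mul_comm (2 : ℝ≥0∞) _ ▸ not_lt.1 hy))
  have hlower : t / 2 * ν B + t / 2 * ν B ≤ ∫⁻ y in B, E y ∂ν + t / 2 * ν B := by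
    rw [setLAverage_eq] at h
    calc t / 2 * ν B + t / 2 * ν B = t * ν B := by rw [← add_mul, ENNReal.add_halves]
      _ ≤ ∫⁻ y in B, G y ∂ν := ENNReal.mul_le_of_le_div h.le
      _ ≤ ∫⁻ y in B, E y + t / 2 ∂ν := lintegral_mono hGE
      _ = ∫⁻ y in B, E y ∂ν + t / 2 * ν B := by
        rw [lintegral_add_right _ measurable_const, setLIntegral_const]
  have hfin : t / 2 * ν B ≠ ∞ :=
    ENNReal.mul_ne_top (ENNReal.div_ne_top htT two_ne_zero) (measure_ne_top ν B)
  have hhalf : t / 2 ≠ 0 := ENNReal.div_ne_zero.2 ⟨ht0, ENNReal.ofNat_ne_top⟩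
  calc ν B = (t / 2)⁻¹ * (t / 2 * ν B) := by
        rw [← mul_assoc, ENNReal.inv_mul_cancel hhalf (ENNReal.div_ne_top htT two_ne_zero), one_mul]
    _ ≤ (t / 2)⁻¹ * ∫⁻ y in B, E y ∂ν :=
        mul_le_mul_right ((ENNReal.add_le_add_iff_right hfin).1 hlower) _
    _ = 2 * t⁻¹ * ∫⁻ y in B, E y ∂ν := by
        rw [ENNReal.inv_div (.inl ENNReal.ofNat_ne_top) (.inl two_ne_zero), div_eq_mul_inv]

variable [Countable ι] {B K : ι → Set X} {φ : ι → X → ℝ≥0∞} {G : X → ℝ≥0∞} {c D : ℝ≥0∞}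

lemma lintegral_iSup_lt_setLAverage_le (hB : ∀ i, MeasurableSet (B i))
    (hBK : HasVitaliEnlargement B K) (hν : ∀ i, ν (K i) ≤ D * ν (B i))
    (hφ : ∀ i, AEMeasurable (φ i) μ)
    (htest : ∀ i, ∫⁻ x, ⨆ j, ⨆ (_ : B j ⊆ K i), φ j x ∂μ ≤ c * ν (K i))
    {t : ℝ≥0∞} (ht0 : t ≠ 0) (htT : t ≠ ∞) :
    ∫⁻ x, ⨆ i, ⨆ (_ : t < ⨍⁻ y in B i, G y ∂ν), φ i x ∂μ ≤
      2 * c * D * t⁻¹ * ∫⁻ y, {y | t < 2 * G y}.indicator G y ∂ν := by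
  obtain ⟨u, hu, hdisj, hcov⟩ := hBK {i | t < ⨍⁻ y in B i, G y ∂ν}
  set E := {y | t < 2 * G y}.indicator G
  have hsup (x : X) : ⨆ i, ⨆ (_ : t < ⨍⁻ y in B i, G y ∂ν), φ i x ≤
      ∑' i : u, ⨆ j, ⨆ (_ : B j ⊆ K i), φ j x := by
    refine iSup₂_le fun j hj => ?_
    obtain ⟨i, hi, hji⟩ := hcov j hj
    exact (le_iSup₂ (f := fun j (_ : B j ⊆ K i) => φ j x) j hji).trans
      (ENNReal.le_tsum (f := fun i : u => ⨆ j, ⨆ (_ : B j ⊆ K i), φ j x) ⟨i, hi⟩)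
  calc ∫⁻ x, ⨆ i, ⨆ (_ : t < ⨍⁻ y in B i, G y ∂ν), φ i x ∂μ
      ≤ ∫⁻ x, ∑' i : u, ⨆ j, ⨆ (_ : B j ⊆ K i), φ j x ∂μ := lintegral_mono hsup
    _ = ∑' i : u, ∫⁻ x, ⨆ j, ⨆ (_ : B j ⊆ K i), φ j x ∂μ :=
        lintegral_tsum fun i => .iSup fun j => .iSup fun _ => hφ j
    _ ≤ ∑' i : u, c * (D * (2 * t⁻¹ * ∫⁻ y in B i, E y ∂ν)) := by
        gcongr with i
        refine (htest i).trans ?_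
        gcongr
        refine (hν i).trans ?_
        gcongr
        exact measure_le_of_lt_setLAverage ht0 htT (hu i.2)
    _ = 2 * c * D * t⁻¹ * ∑' i : u, ∫⁻ y in B i, E y ∂ν := by
        rw [← ENNReal.tsum_mul_left]
        congr with i
        ring
    _ ≤ 2 * c * D * t⁻¹ * ∫⁻ y, E y ∂ν := by
        gcongr
        rw [← lintegral_iUnion (fun i : u => hB i) hdisj.subtype E]
        exact setLIntegral_le_lintegral _ _

theorem lintegral_iSup_mul_setLAverage_rpow_le [SFinite μ] (hB : ∀ i, MeasurableSet (B i))
    (hBK : HasVitaliEnlargement B K) (hD : D ≠ ∞) (hν : ∀ i, ν (K i) ≤ D * ν (B i))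
    (hφ : ∀ i, AEMeasurable (φ i) μ) (hc : c ≠ ∞)
    (htest : ∀ i, ∫⁻ x, ⨆ j, ⨆ (_ : B j ⊆ K i), φ j x ∂μ ≤ c * ν (K i))
    (hG : AEMeasurable G ν) {q : ℝ} (hq : 1 < q) :
    ∫⁻ x, ⨆ i, φ i x * (⨍⁻ y in B i, G y ∂ν) ^ q ∂μ ≤
      ENNReal.ofReal q * (2 * c * D) * (ENNReal.ofReal (q - 1))⁻¹ * ∫⁻ y, (2 * G y) ^ q ∂ν := by
  refine lintegral_iSup_mul_rpow_le_of_weakType hφ _ hG hq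
    (ENNReal.mul_ne_top (ENNReal.mul_ne_top ENNReal.ofNat_ne_top hc) hD) fun t ht => ?_
  rw [← lintegral_indicator₀ (nullMeasurableSet_lt aemeasurable_const (hG.const_mul 2))]
  exact lintegral_iSup_lt_setLAverage_le hB hBK hν hφ htest (by simpa using ht)
    ENNReal.ofReal_ne_top

end MaximalBound

section DualWeight

variable {p w : ℝ → ℝ}

lemma ofReal_mul_dualWeight_rpow {x : ℝ} (hp : 1 < p x) (hw : 0 < w x) (g : ℝ≥0∞) :
    (ENNReal.ofReal (w x) * (g * dualWeight p w x)) ^ p x = g ^ p x * dualWeight p w x := by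
  have hp0 : 0 ≤ p x := by linarith
  have hw0 : ENNReal.ofReal (w x) ≠ 0 := by simpa using hw
  have hne : p x - 1 ≠ 0 := by linarith
  rw [mul_left_comm, ENNReal.mul_rpow_of_nonneg _ _ hp0]
  congr 1
  rw [dualWeight, ENNReal.mul_rpow_of_nonneg _ _ hp0, ← ENNReal.rpow_mul,
    ← ENNReal.rpow_add _ _ hw0 ENNReal.ofReal_ne_top]
  congr 1
  rw [conjExp]
  field_simp
  ring

lemma dualWeight_ne_zero {x : ℝ} (hw : 0 < w x) : dualWeight p w x ≠ 0 := by
  simp [dualWeight, ENNReal.rpow_eq_zero_iff, not_le.2 hw]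

lemma dualWeight_ne_top {x : ℝ} (hw : 0 < w x) : dualWeight p w x ≠ ∞ := by
  simp [dualWeight, ENNReal.rpow_eq_top_iff, not_le.2 hw]

lemma aemeasurable_dualWeight {μ : Measure ℝ} (hp : AEMeasurable p μ) (hw : AEMeasurable w μ) :
    AEMeasurable (dualWeight p w) μ :=
  hw.ennreal_ofReal.pow (hp.div (hp.sub_const 1)).neg

end DualWeight

section DualMeasure

variable {J I : Set ℝ} {p w : ℝ → ℝ}

/-- The measure `w^{-p'(x)} dx` on `J`. -/
noncomputable def dualMeasure (J : Set ℝ) (p w : ℝ → ℝ) : Measure ℝ :=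
  (volume.restrict J).withDensity (dualWeight p w)

lemma dualMeasure_apply (hI : MeasurableSet I) (hIJ : I ⊆ J) :
    dualMeasure J p w I = ∫⁻ x in I, dualWeight p w x := by
  rw [dualMeasure, withDensity_apply _ hI, Measure.restrict_restrict hI,
    inter_eq_self_of_subset_left hIJ]

lemma setLIntegral_dualMeasure (hI : MeasurableSet I) (hIJ : I ⊆ J)
    (hp : AEMeasurable p (volume.restrict J)) (hw : AEMeasurable w (volume.restrict J))
    {g : ℝ → ℝ≥0∞} (hg : AEMeasurable g (volume.restrict J)) :
    ∫⁻ x in I, g x ∂dualMeasure J p w = ∫⁻ x in I, g x * dualWeight p w x := by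
  have hle : volume.restrict I ≤ volume.restrict J := Measure.restrict_mono_set _ hIJ
  rw [dualMeasure, restrict_withDensity hI, Measure.restrict_restrict hI,
    inter_eq_self_of_subset_left hIJ, lintegral_withDensity_eq_lintegral_mul₀
      ((aemeasurable_dualWeight hp hw).mono_measure hle) (hg.mono_measure hle)]
  simp only [Pi.mul_apply, mul_comm]

lemma dualMeasure_restrict (hJ : MeasurableSet J) :
    (dualMeasure J p w).restrict J = dualMeasure J p w := by
  rw [dualMeasure, restrict_withDensity hJ, Measure.restrict_restrict hJ, inter_self]

lemma setLIntegral_dualWeight_ne_zero (hp : AEMeasurable p (volume.restrict J))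
    (hwm : AEMeasurable w (volume.restrict J)) (hw : ∀ᵐ x ∂volume.restrict J, 0 < w x)
    (hIJ : I ⊆ J) (hvol : volume I ≠ 0) :
    ∫⁻ x in I, dualWeight p w x ≠ 0 := by
  intro h0
  rw [lintegral_eq_zero_iff'
    ((aemeasurable_dualWeight hp hwm).mono_measure (Measure.restrict_mono_set _ hIJ))] at h0
  refine hvol (Measure.restrict_eq_zero.1 (ae_eq_bot.1 ?_))
  rw [← eventually_false_iff_eq_bot]
  filter_upwards [h0, ae_restrict_of_ae_restrict_of_subset hIJ hw] with x hx hwx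
  exact dualWeight_ne_zero hwx hx

lemma DoublingOn.exists_logOscillationLE_dualMeasure (hJ : J.OrdConnected)
    (hJb : Bornology.IsBounded J) {pminus pplus : ℝ} (hp : ∀ x ∈ J, p x ∈ Icc pminus pplus)
    (hpLH : LogHolderOn J p) (hwm : AEMeasurable w (volume.restrict J))
    (hw : ∀ᵐ x ∂volume.restrict J, 0 < w x) (hvol : volume J ≠ 0)
    [IsFiniteMeasure (dualMeasure J p w)] (hDC : DoublingOn J (dualWeight p w)) :
    ∃ L, LogOscillationLE (dualMeasure J p w) J p L := by
  have hpm : AEMeasurable p (volume.restrict J) := hpLH.continuousOn.aemeasurable hJ.measurableSet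
  obtain ⟨N, hN⟩ := hDC.exists_hasDoublingExponent hJ hJb
  obtain ⟨K, hK⟩ := hpLH.exists_logOscillationLE hJb hp
  refine hK.of_hasDoublingExponent hN hJ hJb ?_
  rw [dualMeasure_apply hJ.measurableSet le_rfl]
  exact setLIntegral_dualWeight_ne_zero hpm hwm hw le_rfl hvol

end DualMeasure

section FracMaximal

variable {J I : Set ℝ} {α : ℝ} {g h : ℝ → ℝ≥0∞}

/-- The fractional average `|I|^{-(1-α)} ∫_I g`, whose supremum over the intervals `I` is the
fractional maximal function. -/
noncomputable def fracAverage (α : ℝ) (g : ℝ → ℝ≥0∞) (I : Set ℝ) : ℝ≥0∞ :=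
  (∫⁻ y in I, g y) / volume I ^ (1 - α)

lemma fracAverage_le_fracMaximal (hI : I.OrdConnected) {x : ℝ} (hx : x ∈ I) (hIJ : I ⊆ J) :
    fracAverage α g I ≤ fracMaximal J α g x :=
  le_iSup₂_of_le I hI (le_iSup₂_of_le hx hIJ le_rfl)

lemma fracMaximal_congr_ae (hgh : g =ᵐ[volume.restrict J] h) :
    fracMaximal J α g = fracMaximal J α h := by
  funext x
  refine iSup_congr fun I => iSup_congr fun _ => iSup_congr fun _ => iSup_congr fun hIJ => ?_
  rw [lintegral_congr_ae (ae_restrict_of_ae_restrict_of_subset hIJ hgh)]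

lemma fracMaximal_div (g : ℝ → ℝ≥0∞) {a : ℝ≥0∞} (ha : a ≠ 0) (x : ℝ) :
    fracMaximal J α (fun y => g y / a) x = fracMaximal J α g x / a := by
  simp only [fracMaximal, div_eq_mul_inv, ENNReal.iSup_mul,
    lintegral_mul_const' _ _ (ENNReal.inv_ne_top.2 ha), mul_right_comm]

end FracMaximal

section Modular

variable {J : Set ℝ} {p : ℝ → ℝ} {g h : ℝ → ℝ≥0∞}

lemma modular_mono (hJ : MeasurableSet J) (hp : ∀ x ∈ J, 0 ≤ p x) (hgh : ∀ x ∈ J, g x ≤ h x) :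
    modular J p g ≤ modular J p h :=
  setLIntegral_mono' hJ fun x hx => ENNReal.rpow_le_rpow (hgh x hx) (hp x hx)

lemma modular_div_le_one (hJ : MeasurableSet J) (hp : ∀ x ∈ J, 1 ≤ p x) {D : ℝ≥0} (hD : 1 ≤ D)
    (h : modular J p g ≤ D) : modular J p (fun x => g x / D) ≤ 1 := by
  have hD0 : (D : ℝ≥0∞) ≠ 0 := by exact_mod_cast (one_pos.trans_le hD).ne'
  have hDinv : (D : ℝ≥0∞)⁻¹ ≤ 1 := ENNReal.inv_le_one.2 (by exact_mod_cast hD)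
  calc modular J p (fun x => g x / D) ≤ ∫⁻ x in J, g x ^ p x * (D : ℝ≥0∞)⁻¹ := by
        refine setLIntegral_mono' hJ fun x hx => ?_
        simp only [div_eq_mul_inv]
        rw [ENNReal.mul_rpow_of_nonneg _ _ (zero_le_one.trans (hp x hx))]
        gcongr
        exact (ENNReal.rpow_le_rpow_of_exponent_ge hDinv (hp x hx)).trans_eq (ENNReal.rpow_one _)
    _ = modular J p g * (D : ℝ≥0∞)⁻¹ := lintegral_mul_const' _ _ (ENNReal.inv_ne_top.2 hD0)
    _ ≤ D * (D : ℝ≥0∞)⁻¹ := by gcongr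
    _ = 1 := ENNReal.mul_inv_cancel hD0 ENNReal.coe_ne_top

lemma lpNorm_le {l : ℝ≥0} (hl : 0 < l) (h : modular J p (fun x => g x / (l : ℝ≥0∞)) ≤ 1) :
    lpNorm J p g ≤ l :=
  iInf_le_of_le l (iInf₂_le_of_le hl h le_rfl)

lemma modular_div_le_one_of_lpNorm_lt (hJ : MeasurableSet J) (hp : ∀ x ∈ J, 0 ≤ p x) {l : ℝ≥0∞}
    (h : lpNorm J p g < l) : modular J p (fun x => g x / l) ≤ 1 := by
  simp only [lpNorm, iInf_lt_iff] at h
  obtain ⟨k, -, hmod, hkl⟩ := h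
  exact (modular_mono hJ hp fun x _ => ENNReal.div_le_div_left hkl.le _).trans hmod

lemma lpNorm_le_mul_of_modular_le (hJ : MeasurableSet J) (hp : ∀ x ∈ J, 1 ≤ p x) {D : ℝ≥0}
    (hD : 1 ≤ D) (hgh : ∀ l : ℝ≥0, 0 < l → modular J p (fun x => h x / (l : ℝ≥0∞)) ≤ 1 →
      modular J p (fun x => g x / (l : ℝ≥0∞)) ≤ D) :
    lpNorm J p g ≤ D * lpNorm J p h := by
  have hD0 : 0 < D := one_pos.trans_le hD
  rw [lpNorm.eq_1 J p h]
  simp only [ENNReal.mul_iInf_of_ne (ENNReal.coe_ne_zero.2 hD0.ne') ENNReal.coe_ne_top]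
  refine le_iInf fun l => le_iInf₂ fun hl hmod => ?_
  have hdiv (x : ℝ) : g x / (D * l : ℝ≥0) = g x / l / D := by
    rw [ENNReal.coe_mul, mul_comm, div_eq_mul_inv,
      ENNReal.mul_inv (.inr ENNReal.coe_ne_top) (.inl ENNReal.coe_ne_top), ← mul_assoc]
    rfl
  rw [← ENNReal.coe_mul]
  refine lpNorm_le (mul_pos hD0 hl) ?_
  simpa only [hdiv] using modular_div_le_one hJ hp hD (hgh l hl hmod)

end Modular

section Necessity

variable {J : Set ℝ} {p : ℝ → ℝ} {α : ℝ} {v w : ℝ → ℝ}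

lemma TwoWeightInequality.exists_modular_le_one (hJ : MeasurableSet J) (hp : ∀ x ∈ J, 0 ≤ p x)
    (h : TwoWeightInequality J p α v w) :
    ∃ C : ℝ≥0, 1 ≤ C ∧ ∀ f : ℝ → ℝ≥0∞, AEMeasurable f (volume.restrict J) →
      (∀ᵐ x ∂volume.restrict J, f x ≠ ∞) → ∀ l : ℝ≥0∞, l ≠ 0 → l ≠ ∞ →
      modular J p (fun x => ENNReal.ofReal (w x) * f x / l) ≤ 1 →
      modular J p (fun x => ENNReal.ofReal (v x) * fracMaximal J α f x / (C * l)) ≤ 1 := by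
  obtain ⟨c, -, h⟩ := h
  refine ⟨1 + c.toNNReal, le_self_add, fun f hf hfT l hl0 hlT hmod => ?_⟩
  have hae : (fun y => ‖(f y).toReal‖ₑ) =ᵐ[volume.restrict J] f := by
    filter_upwards [hfT] with y hy
    rw [Real.enorm_of_nonneg ENNReal.toReal_nonneg, ENNReal.ofReal_toReal hy]
  have hnorm : lpNorm J p (fun x => ENNReal.ofReal (w x) * ‖(f x).toReal‖ₑ) ≤ l := by
    lift l to ℝ≥0 using hlT
    refine lpNorm_le (by simpa [pos_iff_ne_zero] using hl0) ((lintegral_congr_ae ?_).trans_le hmod)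
    filter_upwards [hae] with y hy
    simp only [hy]
  have hfnorm := h (fun y => (f y).toReal) hf.ennreal_toReal
  rw [fracMaximal_congr_ae hae] at hfnorm
  refine modular_div_le_one_of_lpNorm_lt hJ hp (hfnorm.trans_lt ?_)
  calc ENNReal.ofReal c * lpNorm J p (fun x => ENNReal.ofReal (w x) * ‖(f x).toReal‖ₑ)
      ≤ ENNReal.ofReal c * l := by gcongr
    _ < (1 + ENNReal.ofReal c) * l := by
        rw [ENNReal.mul_lt_mul_iff_left hl0 hlT, add_comm]
        exact ENNReal.lt_add_right ENNReal.ofReal_ne_top one_ne_zero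
    _ = ((1 + c.toNNReal : ℝ≥0) : ℝ≥0∞) * l := by rw [ENNReal.coe_add, ENNReal.coe_one]; rfl

lemma ofReal_mul_rpow_le_of_le_dualWeight {x : ℝ} (hp : 1 < p x) (hw : 0 < w x) {a : ℝ≥0∞}
    (ha : a ≤ dualWeight p w x) : (ENNReal.ofReal (w x) * a) ^ p x ≤ a := by
  have hσ0 := dualWeight_ne_zero (p := p) hw
  have hσT := dualWeight_ne_top (p := p) hw
  have hle : a / dualWeight p w x ≤ 1 := ENNReal.div_le_of_le_mul (by rwa [one_mul])
  have hmul : a / dualWeight p w x * dualWeight p w x = a := ENNReal.div_mul_cancel hσ0 hσT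
  calc (ENNReal.ofReal (w x) * a) ^ p x = (a / dualWeight p w x) ^ p x * dualWeight p w x := by
        rw [← ofReal_mul_dualWeight_rpow hp hw, hmul]
    _ ≤ a / dualWeight p w x * dualWeight p w x := by
        gcongr
        exact (ENNReal.rpow_le_rpow_of_exponent_ge hle hp.le).trans_eq (ENNReal.rpow_one _)
    _ = a := hmul

lemma modular_div_le_one_of_le_dualWeight (hJ : MeasurableSet J) (hp : ∀ x ∈ J, 1 < p x)
    (hw : ∀ᵐ x ∂volume.restrict J, 0 < w x) {f : ℝ → ℝ≥0∞}
    (hf : AEMeasurable f (volume.restrict J)) (hfσ : ∀ x, f x ≤ dualWeight p w x) {l : ℝ≥0∞}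
    (hl : ∀ x ∈ J, f x ≠ 0 → ∫⁻ y in J, f y ≤ l ^ p x) :
    modular J p (fun x => ENNReal.ofReal (w x) * f x / l) ≤ 1 := by
  calc modular J p (fun x => ENNReal.ofReal (w x) * f x / l)
      ≤ ∫⁻ x in J, f x * (∫⁻ y in J, f y)⁻¹ := by
        refine lintegral_mono_ae ?_
        filter_upwards [hw, ae_restrict_mem hJ] with x hwx hxJ
        have hpx := hp x hxJ
        rw [ENNReal.div_rpow_of_nonneg _ _ (by linarith), div_eq_mul_inv]
        rcases eq_or_ne (f x) 0 with hfx | hfx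
        · simp [hfx, ENNReal.zero_rpow_of_pos (zero_lt_one.trans hpx)]
        · gcongr
          · exact ofReal_mul_rpow_le_of_le_dualWeight hpx hwx (hfσ x)
          · exact hl x hxJ hfx
    _ = (∫⁻ x in J, f x) / ∫⁻ y in J, f y := lintegral_mul_const'' _ hf
    _ ≤ 1 := ENNReal.div_self_le_one

lemma le_max_one_inv_modular (hJ : MeasurableSet J) (hp : ∀ x ∈ J, 1 ≤ p x) {g : ℝ → ℝ≥0∞}
    {b : ℝ≥0∞} (h : modular J p (fun x => g x * b) ≤ 1) : b ≤ max 1 (modular J p g)⁻¹ := by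
  rcases le_total b 1 with hb | hb
  · exact le_max_of_le_left hb
  refine le_max_of_le_right (ENNReal.le_inv_iff_mul_le.2 (le_trans ?_ h))
  refine (lintegral_const_mul_le _ _).trans (setLIntegral_mono' hJ fun x hx => ?_)
  rw [ENNReal.mul_rpow_of_nonneg _ _ (zero_le_one.trans (hp x hx)), mul_comm]
  gcongr
  exact (ENNReal.rpow_one b).symm.trans_le (ENNReal.rpow_le_rpow_of_exponent_le hb (hp x hx))

lemma modular_ofReal_ne_zero (hJ : MeasurableSet J) (hp : ∀ x ∈ J, 0 < p x)
    (hpm : AEMeasurable p (volume.restrict J)) (hvm : AEMeasurable v (volume.restrict J))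
    (hv : ∀ᵐ x ∂volume.restrict J, 0 ≤ v x) (hv0 : ¬ ∀ᵐ x ∂volume.restrict J, v x = 0) :
    modular J p (fun x => ENNReal.ofReal (v x)) ≠ 0 := by
  intro h0
  rw [modular, lintegral_eq_zero_iff' (hvm.ennreal_ofReal.pow hpm)] at h0
  refine hv0 ?_
  filter_upwards [h0, hv, ae_restrict_mem hJ] with x hx hvx hxJ
  have hvx' : ENNReal.ofReal (v x) = 0 := (ENNReal.rpow_eq_zero_iff_of_pos (hp x hxJ)).1 hx
  exact le_antisymm (ENNReal.ofReal_eq_zero.1 hvx') hvx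

lemma TwoWeightInequality.exists_lintegral_le (hJ : J.OrdConnected) (hJb : Bornology.IsBounded J)
    (hp : ∀ x ∈ J, 1 ≤ p x) (hV : modular J p (fun x => ENNReal.ofReal (v x)) ≠ 0)
    (h : TwoWeightInequality J p α v w) :
    ∃ C : ℝ≥0∞, C ≠ ∞ ∧ ∀ f : ℝ → ℝ≥0∞, AEMeasurable f (volume.restrict J) →
      (∀ᵐ x ∂volume.restrict J, f x ≠ ∞) → ∀ l : ℝ≥0∞, l ≠ 0 → l ≠ ∞ →
      modular J p (fun x => ENNReal.ofReal (w x) * f x / l) ≤ 1 → ∫⁻ x in J, f x ≤ C * l := by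
  have hp0 : ∀ x ∈ J, 0 ≤ p x := fun x hx => zero_le_one.trans (hp x hx)
  have hvol0 : volume J ≠ 0 := fun h0 => hV (by simp [modular, Measure.restrict_eq_zero.2 h0])
  have hvolT : volume J ≠ ∞ := hJb.measure_lt_top.ne
  have hpow0 : volume J ^ (1 - α) ≠ 0 := by simp [ENNReal.rpow_eq_zero_iff, hvol0, hvolT]
  have hpowT : volume J ^ (1 - α) ≠ ∞ := by simp [ENNReal.rpow_eq_top_iff, hvol0, hvolT]
  obtain ⟨C, hC1, hC⟩ := h.exists_modular_le_one hJ.measurableSet hp0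
  set V := modular J p (fun x => ENNReal.ofReal (v x))
  have hC0 : (C : ℝ≥0∞) ≠ 0 := by exact_mod_cast (one_pos.trans_le hC1).ne'
  have hA : max 1 V⁻¹ ≠ ∞ := by simp [hV]
  refine ⟨max 1 V⁻¹ * C * volume J ^ (1 - α),
    ENNReal.mul_ne_top (ENNReal.mul_ne_top hA ENNReal.coe_ne_top) hpowT,
    fun f hf hfT l hl0 hlT hmod => ?_⟩
  have hCl0 : (C : ℝ≥0∞) * l ≠ 0 := mul_ne_zero hC0 hl0
  have hClT : (C : ℝ≥0∞) * l ≠ ∞ := ENNReal.mul_ne_top ENNReal.coe_ne_top hlT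
  have haverage : fracAverage α f J / (C * l) ≤ max 1 V⁻¹ := by
    refine le_max_one_inv_modular hJ.measurableSet hp
      ((modular_mono hJ.measurableSet hp0 fun x hx => ?_).trans (hC f hf hfT l hl0 hlT hmod))
    rw [← mul_div_assoc]
    gcongr
    exact fracAverage_le_fracMaximal hJ hx le_rfl
  calc ∫⁻ x in J, f x = fracAverage α f J * volume J ^ (1 - α) :=
        (ENNReal.div_mul_cancel hpow0 hpowT).symm
    _ ≤ max 1 V⁻¹ * (C * l) * volume J ^ (1 - α) := by
        gcongr
        exact (ENNReal.div_le_iff_le_mul (.inl hCl0) (.inl hClT)).1 haverage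
    _ = max 1 V⁻¹ * C * volume J ^ (1 - α) * l := by ring

lemma le_max_one_rpow_of_le_mul_rpow {s C : ℝ≥0∞} {θ : ℝ} (hθ : θ < 1) (hs : s ≠ ∞)
    (h : s ≤ C * max 1 s ^ θ) : s ≤ max 1 (C ^ (1 - θ)⁻¹) := by
  rcases le_total s 1 with hs1 | hs1
  · exact le_max_of_le_left hs1
  have hs0 : s ≠ 0 := (one_pos.trans_le hs1).ne'
  have hpow0 : s ^ θ ≠ 0 := by simp [ENNReal.rpow_eq_zero_iff, hs0, hs]
  have hpowT : s ^ θ ≠ ∞ := by simp [ENNReal.rpow_eq_top_iff, hs0, hs]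
  refine le_max_of_le_right ((ENNReal.le_rpow_inv_iff (by linarith)).2 ?_)
  rw [max_eq_right hs1] at h
  rwa [← ENNReal.mul_le_mul_iff_left hpow0 hpowT, ← ENNReal.rpow_add _ _ hs0 hs, sub_add_cancel,
    ENNReal.rpow_one]

lemma lintegral_le_of_forall_lintegral_min_natCast_le {X : Type*} [MeasurableSpace X]
    {μ : Measure X} {f : X → ℝ≥0∞} (hf : AEMeasurable f μ) {C : ℝ≥0∞}
    (h : ∀ k : ℕ, ∫⁻ x, min (f x) k ∂μ ≤ C) : ∫⁻ x, f x ∂μ ≤ C := by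
  have hsup (x : X) : f x = ⨆ k : ℕ, min (f x) k := by
    rw [← inf_iSup_eq, ENNReal.iSup_natCast, inf_top_eq]
  rw [lintegral_congr hsup, lintegral_iSup' (fun k => hf.min aemeasurable_const)
    (.of_forall fun x i j hij => min_le_min_left _ (Nat.cast_le.2 hij))]
  exact iSup_le h

lemma TwoWeightInequality.lintegral_dualWeight_lt_top (hJ : J.OrdConnected)
    (hJb : Bornology.IsBounded J) {pminus : ℝ} (hpminus : 1 < pminus)
    (hp : ∀ x ∈ J, pminus ≤ p x) (hpm : AEMeasurable p (volume.restrict J))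
    (hwm : AEMeasurable w (volume.restrict J)) (hw : ∀ᵐ x ∂volume.restrict J, 0 < w x)
    (hV : modular J p (fun x => ENNReal.ofReal (v x)) ≠ 0) (h : TwoWeightInequality J p α v w) :
    ∫⁻ x in J, dualWeight p w x < ∞ := by
  obtain ⟨C, hCT, hC⟩ := h.exists_lintegral_le hJ hJb (fun x hx => by linarith [hp x hx]) hV
  have hθ : pminus⁻¹ < 1 := inv_lt_one_of_one_lt₀ hpminus
  have hpinv : 0 < pminus⁻¹ := by positivity
  suffices hk : ∀ k : ℕ, ∫⁻ x in J, min (dualWeight p w x) k ≤ max 1 (C ^ (1 - pminus⁻¹)⁻¹) by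
    refine (lintegral_le_of_forall_lintegral_min_natCast_le
      (aemeasurable_dualWeight hpm hwm) hk).trans_lt ?_
    exact max_lt ENNReal.one_lt_top (ENNReal.rpow_lt_top_of_nonneg (by simpa using hθ.le) hCT)
  intro k
  set S := ∫⁻ x in J, min (dualWeight p w x) k
  have hST : S ≠ ∞ := by
    refine ne_top_of_le_ne_top (ENNReal.mul_ne_top (ENNReal.natCast_ne_top k)
      (hJb.measure_lt_top (μ := volume)).ne)
      ((lintegral_mono fun x => min_le_right _ _).trans_eq ?_)
    rw [setLIntegral_const]
  have hσm : AEMeasurable (fun x => min (dualWeight p w x) k) (volume.restrict J) :=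
    (aemeasurable_dualWeight hpm hwm).min aemeasurable_const
  have hmax : 1 ≤ max 1 S := le_max_left _ _
  have hl1 : 1 ≤ max 1 S ^ pminus⁻¹ := ENNReal.one_le_rpow hmax hpinv
  refine le_max_one_rpow_of_le_mul_rpow hθ hST (hC _ hσm (.of_forall fun x => ?_) _
    (one_pos.trans_le hl1).ne' (ENNReal.rpow_ne_top_of_nonneg hpinv.le (by simp [hST])) ?_)
  · exact ne_top_of_le_ne_top (ENNReal.natCast_ne_top k) (min_le_right _ _)
  · refine modular_div_le_one_of_le_dualWeight hJ.measurableSet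
      (fun x hx => hpminus.trans_le (hp x hx)) hw hσm (fun x => min_le_left _ _) fun x hx _ => ?_
    calc S ≤ max 1 S := le_max_right _ _
      _ = (max 1 S ^ pminus⁻¹) ^ pminus := by
          rw [ENNReal.rpow_inv_rpow (by linarith)]
      _ ≤ (max 1 S ^ pminus⁻¹) ^ p x := ENNReal.rpow_le_rpow_of_exponent_le hl1 (hp x hx)

lemma exp_mul_rpow_inv_rpow_mem_Icc {a b s L : ℝ} (ha : 1 ≤ a) (hb : 1 ≤ b) (hs : 0 < s)
    (h : |b - a| * |Real.log s| ≤ L) :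
    (Real.exp L * s ^ a⁻¹) ^ b ∈ Icc s (Real.exp (L * (b + 1)) * s) := by
  have ha0 : 0 < a := by linarith
  have hL : 0 ≤ L := (mul_nonneg (abs_nonneg _) (abs_nonneg _)).trans h
  have hpow : (Real.exp L * s ^ a⁻¹) ^ b = Real.exp (L * b + (b - a) * Real.log s / a) * s := by
    rw [Real.mul_rpow (Real.exp_pos _).le (by positivity), ← Real.exp_mul,
      ← Real.rpow_mul hs.le, Real.rpow_def_of_pos hs]
    nth_rewrite 3 [← Real.exp_log hs]
    rw [← Real.exp_add, ← Real.exp_add]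
    congr 1
    field_simp
    ring
  have habs : |(b - a) * Real.log s / a| ≤ L := by
    rw [abs_div, abs_mul, abs_of_pos ha0]
    exact (div_le_self (by positivity) ha).trans h
  obtain ⟨hlow, hup⟩ := abs_le.1 habs
  rw [hpow]
  constructor
  · exact le_mul_of_one_le_left hs.le (Real.one_le_exp (by nlinarith))
  · gcongr
    linarith

lemma setLIntegral_rpow_le_of_modular_div_le_one {I : Set ℝ} (hI : MeasurableSet I) (hIJ : I ⊆ J)
    (hp : ∀ x ∈ I, 0 ≤ p x) {g : ℝ → ℝ≥0∞} {l T : ℝ≥0∞} (hl : ∀ x ∈ I, l ^ p x ≤ T)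
    (hT0 : T ≠ 0) (hT : T ≠ ∞) (h : modular J p (fun x => g x / l) ≤ 1) :
    ∫⁻ x in I, g x ^ p x ≤ T := by
  rw [← one_mul T, ← ENNReal.div_le_iff hT0 hT]
  calc (∫⁻ x in I, g x ^ p x) / T = ∫⁻ x in I, g x ^ p x / T :=
        (lintegral_mul_const' _ _ (ENNReal.inv_ne_top.2 hT0)).symm
    _ ≤ ∫⁻ x in I, (g x / l) ^ p x := by
        refine setLIntegral_mono' hI fun x hx => ?_
        rw [ENNReal.div_rpow_of_nonneg _ _ (hp x hx)]
        exact ENNReal.div_le_div_left (hl x hx) _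
    _ ≤ modular J p (fun x => g x / l) := lintegral_mono_set hIJ
    _ ≤ 1 := h

lemma LogOscillationLE.exists_rpow_mem_Icc {ν : Measure ℝ} {L : ℝ} (h : LogOscillationLE ν J p L)
    (hp : ∀ x ∈ J, 1 ≤ p x) {I : Set ℝ} (hI : I.OrdConnected) (hIJ : I ⊆ J) (hvol : volume I ≠ 0)
    (hν : 0 < ν.real I) :
    ∃ m : ℝ, 0 < m ∧ ∀ x ∈ I, m ^ p x ∈ Icc (ν.real I) (Real.exp (L * (p x + 1)) * ν.real I) := by
  obtain ⟨x₀, hx₀⟩ := nonempty_of_measure_ne_zero hvol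
  refine ⟨Real.exp L * ν.real I ^ (p x₀)⁻¹, by positivity, fun x hx => ?_⟩
  refine exp_mul_rpow_inv_rpow_mem_Icc (hp x₀ (hIJ hx₀)) (hp x (hIJ hx)) hν ?_
  refine le_trans ?_ (h I hI hIJ hvol x hx x₀ hx₀)
  gcongr
  linarith

lemma modular_indicator_dualWeight_div_le_one (hJ : MeasurableSet J) (hp : ∀ x ∈ J, 1 < p x)
    (hpm : AEMeasurable p (volume.restrict J)) (hwm : AEMeasurable w (volume.restrict J))
    (hw : ∀ᵐ x ∂volume.restrict J, 0 < w x) {I : Set ℝ} (hI : MeasurableSet I) (hIJ : I ⊆ J)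
    {l : ℝ≥0∞} (hl : ∀ x ∈ I, ∫⁻ y in I, dualWeight p w y ≤ l ^ p x) :
    modular J p (fun x => ENNReal.ofReal (w x) * I.indicator (dualWeight p w) x / l) ≤ 1 := by
  refine modular_div_le_one_of_le_dualWeight hJ hp hw ((aemeasurable_dualWeight hpm hwm).indicator
    hI) (indicator_le_self I _) fun x _ hx => ?_
  rw [setLIntegral_indicator hI, inter_eq_self_of_subset_left hIJ]
  exact hl x (mem_of_indicator_ne_zero hx)

lemma TwoWeightInequality.exists_setLIntegral_testing_le (hJ : MeasurableSet J) {pplus : ℝ}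
    (hp : ∀ x ∈ J, 1 < p x) (hpplus : ∀ x ∈ J, p x ≤ pplus)
    (hpm : AEMeasurable p (volume.restrict J)) (hwm : AEMeasurable w (volume.restrict J))
    (hw : ∀ᵐ x ∂volume.restrict J, 0 < w x) [IsFiniteMeasure (dualMeasure J p w)] {L : ℝ}
    (hosc : LogOscillationLE (dualMeasure J p w) J p L) (h : TwoWeightInequality J p α v w) :
    ∃ C : ℝ, 0 < C ∧ ∀ I : Set ℝ, I.OrdConnected → I ⊆ J → volume I ≠ 0 →
      ∫⁻ x in I, ENNReal.ofReal (v x) ^ p x *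
        fracMaximal J α (I.indicator (dualWeight p w)) x ^ p x ≤
      ENNReal.ofReal C * ∫⁻ x in I, dualWeight p w x := by
  have hp0 : ∀ x ∈ J, 0 ≤ p x := fun x hx => (zero_lt_one.trans (hp x hx)).le
  obtain ⟨C, hC1, hC⟩ := h.exists_modular_le_one hJ hp0
  have hC0 : (0 : ℝ) < C := one_pos.trans_le hC1
  refine ⟨C ^ pplus * Real.exp (L * (pplus + 1)), by positivity, fun I hI hIJ hvol => ?_⟩
  have hI' := hI.measurableSet
  set s := (dualMeasure J p w).real I
  have hs : ∫⁻ x in I, dualWeight p w x = ENNReal.ofReal s := by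
    rw [← dualMeasure_apply hI' hIJ, ofReal_measureReal]
  have hspos : 0 < s := by
    rw [← ENNReal.ofReal_pos, ← hs, pos_iff_ne_zero]
    exact setLIntegral_dualWeight_ne_zero hpm hwm hw hIJ hvol
  have hL : 0 ≤ L := hosc.nonneg hI hIJ hvol
  obtain ⟨m, hm, hms⟩ := hosc.exists_rpow_mem_Icc (fun x hx => (hp x hx).le) hI hIJ hvol hspos
  have hmod := hC _ ((aemeasurable_dualWeight hpm hwm).indicator hI') ?_ (ENNReal.ofReal m)
    (by simpa using hm) ENNReal.ofReal_ne_top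
    (modular_indicator_dualWeight_div_le_one hJ hp hpm hwm hw hI' hIJ fun x hx => ?_)
  · rw [hs, ← ENNReal.ofReal_mul (by positivity)]
    refine (setLIntegral_congr_fun hI' fun x hx =>
      (ENNReal.mul_rpow_of_nonneg _ _ (hp0 x (hIJ hx))).symm).trans_le
      (setLIntegral_rpow_le_of_modular_div_le_one hI' hIJ (fun x hx => hp0 x (hIJ hx))
        (fun x hx => ?_) (ENNReal.ofReal_pos.2 (by positivity)).ne' ENNReal.ofReal_ne_top hmod)
    rw [← ENNReal.ofReal_coe_nnreal, ← ENNReal.ofReal_mul hC0.le,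
      ENNReal.ofReal_rpow_of_pos (by positivity), Real.mul_rpow hC0.le hm.le, mul_assoc]
    have hpx := hpplus x (hIJ hx)
    gcongr
    exact (hms x hx).2.trans (by gcongr)
  · filter_upwards [hw] with x hwx
    exact ne_top_of_le_ne_top (dualWeight_ne_top hwx) (indicator_le_self _ _ x)
  · rw [hs, ENNReal.ofReal_rpow_of_pos hm]
    exact ENNReal.ofReal_le_ofReal (hms x hx).1

theorem TwoWeightInequality.testingCondition (hJ : J.OrdConnected) (hJb : Bornology.IsBounded J)
    {pminus pplus : ℝ} (hpminus : 1 < pminus) (hp : ∀ x ∈ J, p x ∈ Icc pminus pplus)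
    (hpLH : LogHolderOn J p) (hvm : AEMeasurable v (volume.restrict J))
    (hwm : AEMeasurable w (volume.restrict J)) (hv : ∀ᵐ x ∂volume.restrict J, 0 ≤ v x)
    (hv0 : ¬ ∀ᵐ x ∂volume.restrict J, v x = 0) (hw : ∀ᵐ x ∂volume.restrict J, 0 < w x)
    (hDC : DoublingOn J (dualWeight p w)) (h : TwoWeightInequality J p α v w) :
    TestingCondition J p α v w := by
  have hp1 : ∀ x ∈ J, 1 < p x := fun x hx => hpminus.trans_le (hp x hx).1
  have hpm : AEMeasurable p (volume.restrict J) := hpLH.continuousOn.aemeasurable hJ.measurableSet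
  have hV := modular_ofReal_ne_zero hJ.measurableSet (fun x hx => zero_lt_one.trans (hp1 x hx))
    hpm hvm hv hv0
  have hvol : volume J ≠ 0 := fun h0 => hV (by simp [modular, Measure.restrict_eq_zero.2 h0])
  have hfin := h.lintegral_dualWeight_lt_top hJ hJb hpminus (fun x hx => (hp x hx).1) hpm hwm hw hV
  have : IsFiniteMeasure (dualMeasure J p w) := isFiniteMeasure_withDensity hfin.ne
  obtain ⟨L, hosc⟩ := hDC.exists_logOscillationLE_dualMeasure hJ hJb hp hpLH hwm hw hvol
  obtain ⟨C, hC, hCI⟩ := h.exists_setLIntegral_testing_le hJ.measurableSet hp1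
    (fun x hx => (hp x hx).2) hpm hwm hw hosc
  refine ⟨C, hC, fun I hI hIJ => ⟨?_, (lintegral_mono_set hIJ).trans_lt hfin⟩⟩
  rcases eq_or_ne (volume I) 0 with hI0 | hI0
  · simp [Measure.restrict_eq_zero.2 hI0]
  · exact hCI I hI hIJ hI0

end Necessity

section RationalIntervals

variable {J : Set ℝ}

/-- The traces on `J` of the intervals with rational endpoints, as far as they have positive
length. They form a countable family, and every subinterval of `J` of positive length lies in one
of them of comparable length. -/
abbrev RatInterval (J : Set ℝ) : Type := {z : ℚ × ℚ // volume (Ioo (z.1 : ℝ) z.2 ∩ J) ≠ 0}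

namespace RatInterval

/-- The interval itself. -/
def toSet (i : RatInterval J) : Set ℝ := Ioo (i.1.1 : ℝ) i.1.2 ∩ J

/-- The trace on `J` of the concentric interval of eight times the length. It contains every
interval of the family that meets `i` and is at most twice as long. -/
def enlargement (i : RatInterval J) : Set ℝ :=
  ball (intervalCenter i.toSet) (2 ^ 3 * intervalRadius i.toSet) ∩ J

lemma toSet_subset (i : RatInterval J) : i.toSet ⊆ J := inter_subset_right

lemma enlargement_subset (i : RatInterval J) : i.enlargement ⊆ J := inter_subset_right

lemma volume_toSet_ne_zero (i : RatInterval J) : volume i.toSet ≠ 0 := i.2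

lemma ordConnected_toSet (hJ : J.OrdConnected) (i : RatInterval J) : i.toSet.OrdConnected :=
  ordConnected_Ioo.inter hJ

lemma ordConnected_enlargement (hJ : J.OrdConnected) (i : RatInterval J) :
    i.enlargement.OrdConnected := by
  rw [enlargement, Real.ball_eq_Ioo]
  exact ordConnected_Ioo.inter hJ

lemma intervalRadius_toSet_pos (hJ : J.OrdConnected) (hJb : Bornology.IsBounded J)
    (i : RatInterval J) : 0 < intervalRadius i.toSet :=
  intervalRadius_pos (i.ordConnected_toSet hJ) (hJb.subset i.toSet_subset) i.volume_toSet_ne_zero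

lemma hasVitaliEnlargement (hJ : J.OrdConnected) (hJb : Bornology.IsBounded J) :
    HasVitaliEnlargement (toSet (J := J)) enlargement := by
  refine hasVitaliEnlargement_of_bounded (δ := fun i => intervalRadius i.toSet)
    (R := volume.real J) (fun i => nonempty_of_measure_ne_zero i.volume_toSet_ne_zero)
    (fun i => ⟨(i.intervalRadius_toSet_pos hJ hJb).le, ?_⟩) fun i j ⟨z, hzj, hzi⟩ hδ y hy =>
      ⟨?_, j.toSet_subset hy⟩
  · have hle : volume.real i.toSet ≤ volume.real J :=
      measureReal_mono i.toSet_subset hJb.measure_lt_top.ne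
    rw [measureReal_eq_two_mul_intervalRadius (i.ordConnected_toSet hJ)
      (hJb.subset i.toSet_subset) i.volume_toSet_ne_zero] at hle
    linarith [i.intervalRadius_toSet_pos hJ hJb]
  · have hi := subset_closedBall_intervalCenter (hJb.subset i.toSet_subset)
    have hj := subset_closedBall_intervalCenter (hJb.subset j.toSet_subset)
    calc dist y (intervalCenter i.toSet)
        ≤ dist y (intervalCenter j.toSet) + dist z (intervalCenter j.toSet) +
          dist z (intervalCenter i.toSet) :=
          (dist_triangle _ z _).trans (by gcongr; exact dist_triangle_right _ _ _)
      _ ≤ 2 * intervalRadius i.toSet + 2 * intervalRadius i.toSet + intervalRadius i.toSet := by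
          gcongr
          exacts [(hj hy).trans hδ, (hj hzj).trans hδ, hi hzi]
      _ < 2 ^ 3 * intervalRadius i.toSet := by linarith [i.intervalRadius_toSet_pos hJ hJb]

lemma measure_enlargement_le (hJ : J.OrdConnected) (hJb : Bornology.IsBounded J)
    {ν : Measure ℝ} {N : ℕ} (hν : HasDoublingExponent ν J N) (i : RatInterval J) :
    ν i.enlargement ≤ (2 ^ 3) ^ N * ν i.toSet := by
  have hi := i.ordConnected_toSet hJ
  have hc := intervalCenter_mem hi (hJb.subset i.toSet_subset) i.volume_toSet_ne_zero
  calc ν i.enlargement ≤ ν (ball (intervalCenter i.toSet) (2 ^ 3 * intervalRadius i.toSet)) :=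
        measure_mono inter_subset_left
    _ ≤ (2 ^ 3) ^ N * ν (ball (intervalCenter i.toSet) (intervalRadius i.toSet)) :=
        hν.measure_ball_two_pow_mul_le (i.toSet_subset hc) (i.intervalRadius_toSet_pos hJ hJb) 3
    _ ≤ (2 ^ 3) ^ N * ν i.toSet := by
        gcongr
        exact ball_intervalCenter_subset hi

lemma exists_superset (hJb : Bornology.IsBounded J) {I : Set ℝ} (hI : I.OrdConnected)
    (hIJ : I ⊆ J) (hvol : volume I ≠ 0) :
    ∃ i : RatInterval J, I ⊆ i.toSet ∧ volume i.toSet ≤ 2 * volume I := by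
  have hIb := hJb.subset hIJ
  have hr := intervalRadius_pos hI hIb hvol
  set c := intervalCenter I
  set r := intervalRadius I
  obtain ⟨a, ha, ha'⟩ := exists_rat_btwn (by linarith : c - 2 * r < c - r)
  obtain ⟨b, hb, hb'⟩ := exists_rat_btwn (by linarith : c + r < c + 2 * r)
  have hsub : I ⊆ Ioo (a : ℝ) b ∩ J := by
    refine subset_inter ((subset_closedBall_intervalCenter hIb).trans ?_) hIJ
    rw [Real.closedBall_eq_Icc]
    exact Icc_subset_Ioo ha' hb
  refine ⟨⟨(a, b), fun h0 => hvol (measure_mono_null hsub h0)⟩, hsub, ?_⟩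
  calc volume (Ioo (a : ℝ) b ∩ J) ≤ volume (Ioo (a : ℝ) b) := measure_mono inter_subset_left
    _ = ENNReal.ofReal (b - a) := Real.volume_Ioo
    _ ≤ ENNReal.ofReal (2 * (2 * r)) := ENNReal.ofReal_le_ofReal (by linarith)
    _ = 2 * volume I := by
        rw [volume_eq_two_mul_intervalRadius hI hIb, ENNReal.ofReal_mul two_pos.le,
          ENNReal.ofReal_ofNat]

end RatInterval

lemma rpow_le_two_rpow_abs_mul_rpow {a b : ℝ≥0∞} (hab : a ≤ b) (hba : b ≤ 2 * a) (s : ℝ) :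
    b ^ s ≤ 2 ^ |s| * a ^ s := by
  rcases le_total 0 s with hs | hs
  · rw [abs_of_nonneg hs, ← ENNReal.mul_rpow_of_nonneg _ _ hs]
    gcongr
  · rw [← neg_neg s, ENNReal.rpow_neg b, ENNReal.rpow_neg a, neg_neg]
    refine (ENNReal.inv_le_inv.2 (ENNReal.rpow_le_rpow hab (neg_nonneg.2 hs))).trans
      (le_mul_of_one_le_left' ?_)
    exact (ENNReal.one_rpow _).symm.trans_le (ENNReal.rpow_le_rpow one_le_two (abs_nonneg s))

lemma fracAverage_le_two_rpow_abs_mul {I B : Set ℝ} (hIB : I ⊆ B) (hB : volume B ≤ 2 * volume I)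
    (α : ℝ) (F : ℝ → ℝ≥0∞) : fracAverage α F I ≤ 2 ^ |1 - α| * fracAverage α F B := by
  have h0 : (2 : ℝ≥0∞) ^ |1 - α| ≠ 0 := by simp
  have hT : (2 : ℝ≥0∞) ^ |1 - α| ≠ ∞ := by simp
  calc fracAverage α F I
      = 2 ^ |1 - α| * ((∫⁻ y in I, F y) / (2 ^ |1 - α| * volume I ^ (1 - α))) := by
        rw [← mul_div_assoc, ENNReal.mul_div_mul_left _ _ h0 hT, fracAverage]
    _ ≤ 2 ^ |1 - α| * fracAverage α F B := by
        rw [fracAverage]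
        gcongr
        exact rpow_le_two_rpow_abs_mul_rpow (measure_mono hIB) hB _

lemma fracMaximal_le_iSup_ratInterval (hJb : Bornology.IsBounded J) (α : ℝ) (F : ℝ → ℝ≥0∞)
    (x : ℝ) :
    fracMaximal J α F x ≤
      2 ^ |1 - α| * ⨆ i : RatInterval J, ⨆ (_ : x ∈ i.toSet), fracAverage α F i.toSet := by
  refine iSup₂_le fun I hI => iSup₂_le fun hxI hIJ => ?_
  rcases eq_or_ne (volume I) 0 with hvol | hvol
  · simp [Measure.restrict_eq_zero.2 hvol]
  obtain ⟨i, hIi, hvoli⟩ := RatInterval.exists_superset hJb hI hIJ hvol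
  refine (fracAverage_le_two_rpow_abs_mul hIi hvoli α F).trans ?_
  gcongr
  exact le_iSup₂_of_le i (hIi hxI) le_rfl

end RationalIntervals

section Sufficiency

variable {J : Set ℝ} {p : ℝ → ℝ} {α : ℝ} {v w : ℝ → ℝ}

/-- The part of `v(x)^{p(x)} (M_α σ(x))^{p(x)}`, where `σ = w^{-p'(·)}`, that is due to the single
interval `B`. It is the weight with which `B` enters the discretized maximal function. -/
noncomputable def testingDensity (p : ℝ → ℝ) (α : ℝ) (v w : ℝ → ℝ) (B : Set ℝ) : ℝ → ℝ≥0∞ :=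
  B.indicator fun x => ENNReal.ofReal (v x) ^ p x * fracAverage α (dualWeight p w) B ^ p x

lemma aemeasurable_testingDensity {μ : Measure ℝ} (hp : AEMeasurable p μ) (hv : AEMeasurable v μ)
    {B : Set ℝ} (hB : MeasurableSet B) : AEMeasurable (testingDensity p α v w B) μ :=
  ((hv.ennreal_ofReal.pow hp).mul (aemeasurable_const.pow hp)).indicator hB

lemma testingDensity_le_indicator (hp : ∀ x ∈ J, 0 ≤ p x) {B K : Set ℝ} (hB : B.OrdConnected)
    (hBK : B ⊆ K) (hKJ : K ⊆ J) (x : ℝ) :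
    testingDensity p α v w B x ≤ K.indicator (fun x => ENNReal.ofReal (v x) ^ p x *
      fracMaximal J α (K.indicator (dualWeight p w)) x ^ p x) x := by
  by_cases hx : x ∈ B
  · have haverage : fracAverage α (dualWeight p w) B =
        fracAverage α (K.indicator (dualWeight p w)) B := by
      rw [fracAverage, fracAverage]
      congr 1
      exact setLIntegral_congr_fun hB.measurableSet fun y hy => (indicator_of_mem (hBK hy) _).symm
    have hpx := hp x (hKJ (hBK hx))
    rw [testingDensity, indicator_of_mem hx, indicator_of_mem (hBK hx), haverage]
    gcongr
    exact fracAverage_le_fracMaximal hB hx (hBK.trans hKJ)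
  · rw [testingDensity, indicator_of_notMem hx]
    exact zero_le

lemma fracAverage_eq_mul_setLAverage (hpm : AEMeasurable p (volume.restrict J))
    (hwm : AEMeasurable w (volume.restrict J)) (hw : ∀ᵐ x ∂volume.restrict J, 0 < w x)
    [IsFiniteMeasure (dualMeasure J p w)] {F : ℝ → ℝ≥0∞} (hF : AEMeasurable F (volume.restrict J))
    {B : Set ℝ} (hB : MeasurableSet B) (hBJ : B ⊆ J) (hvol : volume B ≠ 0) (α : ℝ) :
    fracAverage α F B = fracAverage α (dualWeight p w) B *
      ⨍⁻ y in B, F y / dualWeight p w y ∂dualMeasure J p w := by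
  have hν0 : ∫⁻ y in B, dualWeight p w y ≠ 0 :=
    setLIntegral_dualWeight_ne_zero hpm hwm hw hBJ hvol
  have hνT : ∫⁻ y in B, dualWeight p w y ≠ ∞ := by
    rw [← dualMeasure_apply hB hBJ]
    exact measure_ne_top _ _
  have hint : ∫⁻ y in B, F y / dualWeight p w y * dualWeight p w y = ∫⁻ y in B, F y := by
    refine lintegral_congr_ae ?_
    filter_upwards [ae_restrict_of_ae_restrict_of_subset hBJ hw] with y hwy
    exact ENNReal.div_mul_cancel (dualWeight_ne_zero hwy) (dualWeight_ne_top hwy)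
  rw [setLAverage_eq, dualMeasure_apply hB hBJ, setLIntegral_dualMeasure
    (g := fun y => F y / dualWeight p w y) hB hBJ hpm hwm
    (hF.div (aemeasurable_dualWeight hpm hwm)), hint, fracAverage, fracAverage, mul_comm,
    ← mul_div_assoc, ENNReal.div_mul_cancel hν0 hνT]

lemma lintegral_div_dualWeight_rpow (hJ : MeasurableSet J) (hp : ∀ x ∈ J, 1 < p x)
    (hpm : AEMeasurable p (volume.restrict J)) (hwm : AEMeasurable w (volume.restrict J))
    (hw : ∀ᵐ x ∂volume.restrict J, 0 < w x) {F : ℝ → ℝ≥0∞}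
    (hF : AEMeasurable F (volume.restrict J)) :
    ∫⁻ y, (F y / dualWeight p w y) ^ p y ∂dualMeasure J p w =
      modular J p (fun x => ENNReal.ofReal (w x) * F x) := by
  rw [← dualMeasure_restrict hJ, setLIntegral_dualMeasure
    (g := fun y => (F y / dualWeight p w y) ^ p y) hJ le_rfl hpm hwm
    ((hF.div (aemeasurable_dualWeight hpm hwm)).pow hpm)]
  refine lintegral_congr_ae ?_
  filter_upwards [hw, ae_restrict_mem hJ] with x hwx hxJ
  rw [← ofReal_mul_dualWeight_rpow (hp x hxJ) hwx,
    ENNReal.div_mul_cancel (dualWeight_ne_zero hwx) (dualWeight_ne_top hwx)]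

lemma fracAverage_rpow_le {q pplus L : ℝ} (hq : 1 < q) (hp : ∀ x ∈ J, p x ∈ Icc q pplus)
    (hpm : AEMeasurable p (volume.restrict J)) (hwm : AEMeasurable w (volume.restrict J))
    (hw : ∀ᵐ x ∂volume.restrict J, 0 < w x) [IsFiniteMeasure (dualMeasure J p w)]
    (hosc : LogOscillationLE (dualMeasure J p w) J p L) {F : ℝ → ℝ≥0∞}
    (hF : AEMeasurable F (volume.restrict J))
    (hFp : ∫⁻ y, (F y / dualWeight p w y) ^ p y ∂dualMeasure J p w ≤ 1)
    {B : Set ℝ} (hB : B.OrdConnected) (hBJ : B ⊆ J) (hvol : volume B ≠ 0) {x : ℝ} (hx : x ∈ B) :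
    fracAverage α F B ^ p x ≤ 2 ^ pplus * ENNReal.ofReal (Real.exp (L * q)) *
      (fracAverage α (dualWeight p w) B ^ p x * (⨍⁻ y in B,
        ((F y / dualWeight p w y) ^ (p y / q) + 1) ∂dualMeasure J p w) ^ q) := by
  have hBm := hB.measurableSet
  have hpx := hp x (hBJ hx)
  have hνB : dualMeasure J p w B ≠ 0 := by
    rw [dualMeasure_apply hBm hBJ]
    exact setLIntegral_dualWeight_ne_zero hpm hwm hw hBJ hvol
  have hgm : AEMeasurable (fun y => F y / dualWeight p w y) (dualMeasure J p w) :=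
    (hF.div (aemeasurable_dualWeight hpm hwm)).mono_ac (withDensity_absolutelyContinuous _ _)
  have hJensen := setLAverage_rpow_le hνB hgm.restrict hq.le hpx.1 (hosc.nonneg hB hBJ hvol)
    ((ae_restrict_mem hBm).mono fun y hy => ⟨(hp y (hBJ hy)).1, le_trans
      (by gcongr; exact le_abs_self _) (hosc B hB hBJ hvol x hx y hy)⟩)
    ((setLIntegral_le_lintegral _ _).trans hFp)
  rw [fracAverage_eq_mul_setLAverage hpm hwm hw hF hBm hBJ hvol,
    ENNReal.mul_rpow_of_nonneg _ _ (by linarith [hpx.1]), mul_left_comm]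
  gcongr
  refine hJensen.trans ?_
  gcongr
  exacts [one_le_two, hpx.2]

lemma rpow_ofReal_mul_fracMaximal_le (hJ : J.OrdConnected) (hJb : Bornology.IsBounded J)
    {q pplus L : ℝ} (hq : 1 < q) (hp : ∀ x ∈ J, p x ∈ Icc q pplus)
    (hpm : AEMeasurable p (volume.restrict J)) (hwm : AEMeasurable w (volume.restrict J))
    (hw : ∀ᵐ x ∂volume.restrict J, 0 < w x) [IsFiniteMeasure (dualMeasure J p w)]
    (hosc : LogOscillationLE (dualMeasure J p w) J p L) {F : ℝ → ℝ≥0∞}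
    (hF : AEMeasurable F (volume.restrict J))
    (hFp : ∫⁻ y, (F y / dualWeight p w y) ^ p y ∂dualMeasure J p w ≤ 1) {x : ℝ} (hx : x ∈ J) :
    (ENNReal.ofReal (v x) * fracMaximal J α F x) ^ p x ≤
      (2 ^ |1 - α|) ^ pplus * (2 ^ pplus * ENNReal.ofReal (Real.exp (L * q))) *
        ⨆ i : RatInterval J, testingDensity p α v w i.toSet x * (⨍⁻ y in i.toSet,
          ((F y / dualWeight p w y) ^ (p y / q) + 1) ∂dualMeasure J p w) ^ q := by
  have hpx := hp x hx
  have hpx0 : 0 < p x := by linarith [hpx.1]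
  have hone : (1 : ℝ≥0∞) ≤ 2 ^ |1 - α| :=
    (ENNReal.one_rpow _).symm.trans_le (ENNReal.rpow_le_rpow one_le_two (abs_nonneg _))
  set A : RatInterval J → ℝ≥0∞ := fun i =>
    ⨍⁻ y in i.toSet, ((F y / dualWeight p w y) ^ (p y / q) + 1) ∂dualMeasure J p w
  set E : ℝ≥0∞ := 2 ^ pplus * ENNReal.ofReal (Real.exp (L * q))
  set Y := ⨆ i, testingDensity p α v w i.toSet x * A i ^ q
  have hsingle (i : RatInterval J) (hxi : x ∈ i.toSet) :
      (ENNReal.ofReal (v x) * fracAverage α F i.toSet) ^ p x ≤ E * Y := by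
    calc (ENNReal.ofReal (v x) * fracAverage α F i.toSet) ^ p x
        ≤ ENNReal.ofReal (v x) ^ p x *
            (E * (fracAverage α (dualWeight p w) i.toSet ^ p x * A i ^ q)) := by
          rw [ENNReal.mul_rpow_of_nonneg _ _ hpx0.le]
          gcongr
          exact fracAverage_rpow_le hq hp hpm hwm hw hosc hF hFp (i.ordConnected_toSet hJ)
            i.toSet_subset i.volume_toSet_ne_zero hxi
      _ = E * (testingDensity p α v w i.toSet x * A i ^ q) := by
          rw [testingDensity, indicator_of_mem hxi]
          ring
      _ ≤ E * Y := by
          gcongr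
          exact le_iSup (fun i => testingDensity p α v w i.toSet x * A i ^ q) i
  have hmaximal : ENNReal.ofReal (v x) * fracMaximal J α F x ≤
      2 ^ |1 - α| * (E * Y) ^ (p x)⁻¹ := by
    refine (mul_le_mul_right (fracMaximal_le_iSup_ratInterval hJb α F x) _).trans ?_
    rw [mul_left_comm]
    gcongr
    simp only [ENNReal.mul_iSup]
    exact iSup₂_le fun i hxi => (ENNReal.le_rpow_inv_iff hpx0).2 (hsingle i hxi)
  refine (ENNReal.rpow_le_rpow hmaximal hpx0.le).trans ?_
  rw [ENNReal.mul_rpow_of_nonneg _ _ hpx0.le, ENNReal.rpow_inv_rpow hpx0.ne', ← mul_assoc _ E Y]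
  gcongr
  exact hpx.2

lemma TestingCondition.exists_lintegral_iSup_le (hJ : J.OrdConnected)
    (hJb : Bornology.IsBounded J) (hp : ∀ x ∈ J, 0 ≤ p x)
    (hpm : AEMeasurable p (volume.restrict J)) (hvm : AEMeasurable v (volume.restrict J))
    [IsFiniteMeasure (dualMeasure J p w)] (hDC : DoublingOn J (dualWeight p w))
    (h : TestingCondition J p α v w) {q : ℝ} (hq : 1 < q) :
    ∃ C : ℝ≥0∞, C ≠ ∞ ∧ ∀ G : ℝ → ℝ≥0∞, AEMeasurable G (dualMeasure J p w) →
      ∫⁻ x in J, ⨆ i : RatInterval J, testingDensity p α v w i.toSet x *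
        (⨍⁻ y in i.toSet, G y ∂dualMeasure J p w) ^ q ≤
      C * ∫⁻ y, (2 * G y) ^ q ∂dualMeasure J p w := by
  obtain ⟨c, -, htest⟩ := h
  obtain ⟨N, hN : HasDoublingExponent (dualMeasure J p w) J N⟩ :=
    hDC.exists_hasDoublingExponent hJ hJb
  have hKtest (i : RatInterval J) : ∫⁻ x in J, ⨆ j : RatInterval J,
      ⨆ (_ : j.toSet ⊆ i.enlargement), testingDensity p α v w j.toSet x ≤
        ENNReal.ofReal c * dualMeasure J p w i.enlargement := by
    have hK := i.ordConnected_enlargement hJ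
    have hKJ := i.enlargement_subset
    rw [dualMeasure_apply hK.measurableSet hKJ]
    refine le_trans ?_ (htest _ hK hKJ).1
    rw [← inter_eq_self_of_subset_left hKJ, ← setLIntegral_indicator hK.measurableSet,
      inter_eq_self_of_subset_left hKJ]
    exact lintegral_mono fun x => iSup₂_le fun j hj =>
      testingDensity_le_indicator hp (j.ordConnected_toSet hJ) hj hKJ x
  refine ⟨_, ?_, fun G hG => lintegral_iSup_mul_setLAverage_rpow_le
    (fun i => (i.ordConnected_toSet hJ).measurableSet)
    (RatInterval.hasVitaliEnlargement hJ hJb) (D := (2 ^ 3) ^ N) (by finiteness)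
    (fun i => i.measure_enlargement_le hJ hJb hN)
    (fun i => aemeasurable_testingDensity hpm hvm (i.ordConnected_toSet hJ).measurableSet)
    ENNReal.ofReal_ne_top hKtest hG hq⟩
  have hq' : ENNReal.ofReal (q - 1) ≠ 0 := by simpa using hq
  finiteness

lemma lintegral_rpow_div_add_one_rpow_le {X : Type*} [MeasurableSpace X] {ν : Measure X}
    {g : X → ℝ≥0∞} {p : X → ℝ} {q : ℝ} (hq : 1 ≤ q) (hg : ∫⁻ y, g y ^ p y ∂ν ≤ 1) :
    ∫⁻ y, (2 * (g y ^ (p y / q) + 1)) ^ q ∂ν ≤ 2 ^ q * 2 ^ (q - 1) * (1 + ν univ) := by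
  have hq0 : 0 < q := by linarith
  calc ∫⁻ y, (2 * (g y ^ (p y / q) + 1)) ^ q ∂ν
      ≤ ∫⁻ y, 2 ^ q * 2 ^ (q - 1) * (g y ^ p y + 1) ∂ν := by
        refine lintegral_mono fun y => ?_
        rw [ENNReal.mul_rpow_of_nonneg _ _ hq0.le, mul_assoc]
        gcongr
        refine (ENNReal.rpow_add_le_mul_rpow_add_rpow _ _ hq).trans_eq ?_
        rw [← ENNReal.rpow_mul, div_mul_cancel₀ _ hq0.ne', ENNReal.one_rpow]
    _ = 2 ^ q * 2 ^ (q - 1) * (∫⁻ y, g y ^ p y ∂ν + ν univ) := by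
        rw [lintegral_const_mul' _ _ (by finiteness), lintegral_add_right _ measurable_const,
          lintegral_one]
    _ ≤ 2 ^ q * 2 ^ (q - 1) * (1 + ν univ) := by gcongr

lemma TestingCondition.exists_modular_fracMaximal_le (hJ : J.OrdConnected)
    (hJb : Bornology.IsBounded J) (hvol : volume J ≠ 0) {q pplus : ℝ} (hq : 1 < q)
    (hp : ∀ x ∈ J, p x ∈ Icc q pplus) (hpLH : LogHolderOn J p)
    (hvm : AEMeasurable v (volume.restrict J)) (hwm : AEMeasurable w (volume.restrict J))
    (hw : ∀ᵐ x ∂volume.restrict J, 0 < w x) (hDC : DoublingOn J (dualWeight p w))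
    (h : TestingCondition J p α v w) :
    ∃ C : ℝ≥0∞, C ≠ ∞ ∧ ∀ F : ℝ → ℝ≥0∞, AEMeasurable F (volume.restrict J) →
      modular J p (fun x => ENNReal.ofReal (w x) * F x) ≤ 1 →
      modular J p (fun x => ENNReal.ofReal (v x) * fracMaximal J α F x) ≤ C := by
  have hJm := hJ.measurableSet
  have hp1 : ∀ x ∈ J, 1 < p x := fun x hx => hq.trans_le (hp x hx).1
  have hpm : AEMeasurable p (volume.restrict J) := hpLH.continuousOn.aemeasurable hJm
  have : IsFiniteMeasure (dualMeasure J p w) :=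
    isFiniteMeasure_withDensity (h.choose_spec.2 J hJ le_rfl).2.ne
  obtain ⟨L, hosc⟩ := hDC.exists_logOscillationLE_dualMeasure hJ hJb hp hpLH hwm hw hvol
  obtain ⟨C, hCT, hC⟩ := h.exists_lintegral_iSup_le hJ hJb
    (fun x hx => (zero_lt_one.trans (hp1 x hx)).le) hpm hvm hDC hq
  have hET : ((2 : ℝ≥0∞) ^ |1 - α|) ^ pplus *
      (2 ^ pplus * ENNReal.ofReal (Real.exp (L * q))) ≠ ∞ := by finiteness
  refine ⟨(2 ^ |1 - α|) ^ pplus * (2 ^ pplus * ENNReal.ofReal (Real.exp (L * q))) *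
    (C * (2 ^ q * 2 ^ (q - 1) * (1 + dualMeasure J p w univ))), by finiteness,
    fun F hF hmod => ?_⟩
  rw [← lintegral_div_dualWeight_rpow hJm hp1 hpm hwm hw hF] at hmod
  have hGm : AEMeasurable (fun y => (F y / dualWeight p w y) ^ (p y / q) + 1)
      (dualMeasure J p w) :=
    (((hF.div (aemeasurable_dualWeight hpm hwm)).pow (hpm.div_const q)).add_const 1).mono_ac
      (withDensity_absolutelyContinuous _ _)
  calc modular J p (fun x => ENNReal.ofReal (v x) * fracMaximal J α F x)
      ≤ ∫⁻ x in J, _ := setLIntegral_mono' hJm fun x hx =>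
        rpow_ofReal_mul_fracMaximal_le hJ hJb hq hp hpm hwm hw hosc hF hmod hx
    _ = _ * ∫⁻ x in J, _ := lintegral_const_mul' _ _ hET
    _ ≤ _ := by
        gcongr
        exact (hC _ hGm).trans (by gcongr; exact lintegral_rpow_div_add_one_rpow_le hq.le hmod)

theorem TestingCondition.twoWeightInequality (hJ : J.OrdConnected) (hJb : Bornology.IsBounded J)
    (hvol : volume J ≠ 0) {pminus pplus : ℝ} (hpminus : 1 < pminus)
    (hp : ∀ x ∈ J, p x ∈ Icc pminus pplus) (hpLH : LogHolderOn J p)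
    (hvm : AEMeasurable v (volume.restrict J)) (hwm : AEMeasurable w (volume.restrict J))
    (hw : ∀ᵐ x ∂volume.restrict J, 0 < w x) (hDC : DoublingOn J (dualWeight p w))
    (h : TestingCondition J p α v w) : TwoWeightInequality J p α v w := by
  obtain ⟨C, hCT, hC⟩ := h.exists_modular_fracMaximal_le hJ hJb hvol hpminus hp hpLH hvm hwm hw
    hDC
  lift C to ℝ≥0 using hCT
  have hD : 1 ≤ max 1 C := le_max_left _ _
  refine ⟨((max 1 C : ℝ≥0) : ℝ), by exact_mod_cast one_pos.trans_le hD, fun f hf => ?_⟩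
  rw [ENNReal.ofReal_coe_nnreal]
  refine lpNorm_le_mul_of_modular_le hJ.measurableSet
    (fun x hx => hpminus.le.trans (hp x hx).1) hD fun l hl hmod => ?_
  simp only [mul_div_assoc] at hmod ⊢
  refine le_trans ?_ ((hC (fun x => ‖f x‖ₑ / l) (hf.enorm.div_const _) hmod).trans
    (by exact_mod_cast le_max_right _ _))
  simp only [fracMaximal_div _ (ENNReal.coe_ne_zero.2 hl.ne'), le_refl]

end Sufficiency

end VarExp

theorem theorem1p1_general (J : Set ℝ) (hJ : J.OrdConnected) (hJb : Bornology.IsBounded J)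
    (p : ℝ → ℝ) (pminus pplus : ℝ) (hpminus : 1 < pminus)
    (hp : ∀ x ∈ J, pminus ≤ p x ∧ p x ≤ pplus) (hpLH : VarExp.LogHolderOn J p) (α : ℝ)
    (v w : ℝ → ℝ)
    (hvm : AEMeasurable v (volume.restrict J)) (hwm : AEMeasurable w (volume.restrict J))
    (hv : ∀ᵐ x ∂volume.restrict J, 0 ≤ v x) (hv0 : ¬ ∀ᵐ x ∂volume.restrict J, v x = 0)
    (hw : ∀ᵐ x ∂volume.restrict J, 0 < w x)
    (hDC : VarExp.DoublingOn J (VarExp.dualWeight p w)) :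
    VarExp.TwoWeightInequality J p α v w ↔ VarExp.TestingCondition J p α v w := by
  have hvol : volume J ≠ 0 := fun h0 => hv0 <| by
    rw [Measure.restrict_eq_zero.2 h0, ae_zero]
    exact Filter.eventually_bot
  exact ⟨fun h => h.testingCondition hJ hJb hpminus hp hpLH hvm hwm hv hv0 hw hDC,
    fun h => h.twoWeightInequality hJ hJb hvol hpminus hp hpLH hvm hwm hw hDC⟩

theorem theorem1p1 (J : Set ℝ) (hJ : J.OrdConnected) (hJb : Bornology.IsBounded J)
    (p : ℝ → ℝ) (pminus pplus : ℝ) (hpminus : 1 < pminus)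
    (hp : ∀ x ∈ J, pminus ≤ p x ∧ p x ≤ pplus) (hpLH : VarExp.LogHolderOn J p)
    (α : ℝ) (hα0 : 0 ≤ α) (hα1 : α < 1)
    (v w : ℝ → ℝ)
    (hvm : AEMeasurable v (volume.restrict J)) (hwm : AEMeasurable w (volume.restrict J))
    (hv : ∀ᵐ x ∂volume.restrict J, 0 ≤ v x) (hv0 : ¬ ∀ᵐ x ∂volume.restrict J, v x = 0)
    (hw : ∀ᵐ x ∂volume.restrict J, 0 < w x)
    (hDC : VarExp.DoublingOn J (VarExp.dualWeight p w)) :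
    VarExp.TwoWeightInequality J p α v w ↔ VarExp.TestingCondition J p α v w :=
  theorem1p1_general J hJ hJb p pminus pplus hpminus hp hpLH α v w hvm hwm hv hv0 hw hDC
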